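/- Let $T^k=(S^1)^k$. A smooth action of $T^k$ on a smooth manifold $M$ (Hausdorff, second countable, without boundary, not necessarily compact) is called locally standard if every orbit has an open invariant neighbourhood which is equivariantly diffeomorphic to some $V=\mathbb{C}^n\times T^{k-n}\times\mathbb{R}^m$ ($n,m$ may depend on the orbit), where, after a splitting $T^k\cong T^n\times T^{k-n}$, the factor $T^n$ acts on $\mathbb{C}^n$ by coordinatewise multiplication, $T^{k-n}$ acts on itself by left multiplication, and $T^k$ acts trivially on $\mathbb{R}^m$. Such an equivariant diffeomorphism is called a standard chart. Let $\pi:M\to P=M/T^k$ be the orbit map. Each standard chart induces a chart of $P$ with values in $\mathbb{R}_{\ge 0}^n\times\mathbb{R}^m$ through $(z_1,\dots,z_n,u,y)\mapsto(|z_1|^2,\dots,|z_n|^2,y)$, and these charts make $P$ a smooth manifold with corners. The characteristic function $\lambda$ of $M$ assigns to each orbit in $P$ its isotropy group, a subgroup of $T^k$. A section $s:P\to M$ of $\pi$ is called regular if every point of $P$ has an open neighbourhood on which, in the coordinates given by a standard chart and its induced chart of $P$, it has the form $s(x,y)=f(x,y)\cdot(\sqrt{x_1},\dots,\sqrt{x_n},1,y)$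 with a smooth map $f$ to $T^k$. Theorem. Let $M_i$, $i=1,2$, be two locally standard $T^k$-manifolds with orbit spaces $P_i$ and characteristic functions $\lambda_i$. Assume that there are regular sections $s_i:P_i\to M_i$. If $\Phi:P_1\to P_2$ is a diffeomorphism of manifolds with corners such that $\lambda_1=\lambda_2\circ\Phi$, then there is a unique equivariant diffeomorphism $\Psi:M_1\to M_2$ such that $\Psi\circ s_1=s_2\circ\Phi$. -/

import Mathlib

open scoped Manifold ContDiff

/-- The compact torus `T^k = (S¹)^k`. -/
abbrev Torus (k : ℕ) : Type := Fin k → Circle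

/-- The model with corners for the product smooth structure on `T^k`. -/
noncomputable abbrev torusModel (k : ℕ) :
    ModelWithCorners ℝ (Fin k → EuclideanSpace ℝ (Fin 1))
      (ModelPi fun _ : Fin k => EuclideanSpace ℝ (Fin 1)) :=
  ModelWithCorners.pi fun _ : Fin k => 𝓡 1

/-- The standard space `V = ℂ^n × T^l × ℝ^m`. -/
abbrev StdSpace (n l m : ℕ) : Type := (Fin n → ℂ) × Torus l × (Fin m → ℝ)

/-- The model with corners for the smooth structure on `ℂ^n × T^l × ℝ^m`. -/
noncomputable abbrev stdModel (n l m : ℕ) :=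
  (𝓘(ℝ, Fin n → ℂ)).prod ((torusModel l).prod 𝓘(ℝ, Fin m → ℝ))

/-- The standard action of `T^n × T^l` on `ℂ^n × T^l × ℝ^m`: coordinatewise multiplication on
`ℂ^n`, left multiplication on `T^l`, and the trivial action on `ℝ^m`. -/
noncomputable def stdAct {n l m : ℕ} (t : Torus n × Torus l) (v : StdSpace n l m) :
    StdSpace n l m :=
  (fun i => (t.1 i : ℂ) * v.1 i, t.2 * v.2.1, v.2.2)

/-- The Euclidean space containing the corner `ℝ_{≥0}^n × ℝ^m`. -/
abbrev CornerSpace (n m : ℕ) : Type := (Fin n → ℝ) × (Fin m → ℝ)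

/-- The corner `ℝ_{≥0}^n × ℝ^m`. -/
def corner (n m : ℕ) : Set (CornerSpace n m) := {w | ∀ i, 0 ≤ w.1 i}

/-- The orbit map `(z, u, y) ↦ (|z_1|², …, |z_n|², y)` of the standard action. -/
noncomputable def stdOrbitMap {n l m : ℕ} (v : StdSpace n l m) : CornerSpace n m :=
  (fun i => ‖v.1 i‖ ^ 2, v.2.2)

/-- The standard section `s₀(r, y) = (√r_1, …, √r_n, 1, y)` of the orbit map of the standard
action. -/
noncomputable def stdSection {n l m : ℕ} (w : CornerSpace n m) : StdSpace n l m :=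
  (fun i => ((Real.sqrt (w.1 i) : ℝ) : ℂ), 1, w.2)

/-- A standard chart of a `d`-dimensional manifold `M` with an action of `T^k`: an equivariant
diffeomorphism from an open invariant subset of `M` onto some `ℂ^n × T^l × ℝ^m`, where `T^k` acts
on the target through a splitting `T^k ≅ T^n × T^l` and the standard action. -/
structure StandardChart (k d : ℕ) (M : Type*) [TopologicalSpace M]
    [ChartedSpace (EuclideanSpace ℝ (Fin d)) M] [MulAction (Torus k) M] where
  n : ℕ
  l : ℕ
  m : ℕ
  n_add_l : n + l = k
  split : Torus k ≃ₜ* Torus n × Torus l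
  e : OpenPartialHomeomorph M (StdSpace n l m)
  target_eq : e.target = Set.univ
  smul_mem : ∀ (t : Torus k) (x : M), x ∈ e.source → t • x ∈ e.source
  equivariant : ∀ (t : Torus k) (x : M), x ∈ e.source → e (t • x) = stdAct (split t) (e x)
  contMDiffOn_toFun : ContMDiffOn (𝓡 d) (stdModel n l m) ∞ e e.source
  contMDiff_invFun : ContMDiff (stdModel n l m) (𝓡 d) ∞ e.symm

/-- A smooth `T^k`-action on the `d`-manifold `M` is locally standard if every orbit has an
invariant open neighbourhood which is the domain of a standard chart. -/
def IsLocallyStandard (k d : ℕ) (M : Type*) [TopologicalSpace M]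
    [ChartedSpace (EuclideanSpace ℝ (Fin d)) M] [MulAction (Torus k) M] : Prop :=
  ∀ x : M, ∃ c : StandardChart k d M, MulAction.orbit (Torus k) x ⊆ c.e.source

/-- The orbit space `M / T^k`, with the quotient topology. -/
abbrev OrbitSpace (k : ℕ) (M : Type*) [MulAction (Torus k) M] : Type _ :=
  MulAction.orbitRel.Quotient (Torus k) M

/-- The orbit map `M → M / T^k`. -/
noncomputable def orbitMk (k : ℕ) {M : Type*} [MulAction (Torus k) M] (x : M) : OrbitSpace k M :=
  Quotient.mk (MulAction.orbitRel (Torus k) M) x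

/-- The characteristic function of `M`, which maps each orbit to its isotropy group. -/
noncomputable def characteristicFunction (k : ℕ) {M : Type*} [MulAction (Torus k) M] (p : OrbitSpace k M) :
    Subgroup (Torus k) :=
  Quotient.lift (s := MulAction.orbitRel (Torus k) M)
    (fun x : M => MulAction.stabilizer (Torus k) x)
    (by
      rintro x y ⟨g, rfl⟩
      ext t
      simp only [MulAction.mem_stabilizer_iff]
      rw [smul_smul, mul_comm, ← smul_smul, smul_left_cancel_iff]) p

namespace StandardChart

variable {k d : ℕ} {M : Type*} [TopologicalSpace M]
  [ChartedSpace (EuclideanSpace ℝ (Fin d)) M] [MulAction (Torus k) M]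

/-- The open subset of the orbit space over which the standard chart is defined. -/
noncomputable def orbitDomain (c : StandardChart k d M) : Set (OrbitSpace k M) :=
  orbitMk k '' c.e.source

open Classical in
/-- The chart `M / T^k ⊇ U → ℝ_{≥0}^n × ℝ^m` of the orbit space induced by a standard chart,
`[x] ↦ (|z_1|², …, |z_n|², y)` where `(z, u, y)` are the coordinates of `x`
(with value `0` outside of `c.orbitDomain`). -/
noncomputable def orbitChart (c : StandardChart k d M) (p : OrbitSpace k M) :
    CornerSpace c.n c.m :=
  Quotient.lift (s := MulAction.orbitRel (Torus k) M)
    (fun x : M => if x ∈ c.e.source then stdOrbitMap (c.e x) else 0)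
    (by
      rintro x y ⟨g, rfl⟩
      by_cases hy : y ∈ c.e.source
      · have hgy := c.smul_mem g y hy
        simp only [hy, hgy, if_true, c.equivariant g y hy]
        simp only [stdOrbitMap, stdAct, norm_mul, Circle.norm_coe, one_mul]
      · have hgy : g • y ∉ c.e.source := fun h => hy (by simpa using c.smul_mem g⁻¹ _ h)
        simp only [hy, hgy, if_false]) p

/-- The standard section `s₀` in the coordinates of a standard chart, as a map to `M`. -/
noncomputable def localSection (c : StandardChart k d M) (w : CornerSpace c.n c.m) : M :=
  c.e.symm (stdSection w)

/-- The inverse `ℝ_{≥0}^n × ℝ^m → U ⊆ M / T^k` of the chart `c.orbitChart`. -/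
noncomputable def orbitChartInv (c : StandardChart k d M) (w : CornerSpace c.n c.m) :
    OrbitSpace k M :=
  orbitMk k (c.localSection w)

end StandardChart

/-- A map `Φ` between orbit spaces is smooth at `p`, for the structures of manifolds with corners
given by the charts induced by standard charts: it is continuous at `p`, and in some such charts
around `p` and `Φ p` it is smooth in a neighbourhood of `p`. -/
def OrbitSmoothAt (k d₁ d₂ : ℕ) {M₁ M₂ : Type*}
    [TopologicalSpace M₁] [ChartedSpace (EuclideanSpace ℝ (Fin d₁)) M₁] [MulAction (Torus k) M₁]
    [TopologicalSpace M₂] [ChartedSpace (EuclideanSpace ℝ (Fin d₂)) M₂] [MulAction (Torus k) M₂]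
    (Φ : OrbitSpace k M₁ → OrbitSpace k M₂) (p : OrbitSpace k M₁) : Prop :=
  ContinuousAt Φ p ∧
  ∃ (c₁ : StandardChart k d₁ M₁) (c₂ : StandardChart k d₂ M₂),
    p ∈ c₁.orbitDomain ∧ Φ p ∈ c₂.orbitDomain ∧
    ∃ W : Set (CornerSpace c₁.n c₁.m), IsOpen W ∧ c₁.orbitChart p ∈ W ∧
      ContDiffOn ℝ ∞ (fun w => c₂.orbitChart (Φ (c₁.orbitChartInv w))) (corner c₁.n c₁.m ∩ W)

/-- A bijection between orbit spaces is a diffeomorphism (of manifolds with corners) if it and its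
inverse are smooth at every point. -/
def IsOrbitDiffeomorphism (k d₁ d₂ : ℕ) {M₁ M₂ : Type*}
    [TopologicalSpace M₁] [ChartedSpace (EuclideanSpace ℝ (Fin d₁)) M₁] [MulAction (Torus k) M₁]
    [TopologicalSpace M₂] [ChartedSpace (EuclideanSpace ℝ (Fin d₂)) M₂] [MulAction (Torus k) M₂]
    (Φ : OrbitSpace k M₁ ≃ OrbitSpace k M₂) : Prop :=
  (∀ p, OrbitSmoothAt k d₁ d₂ Φ p) ∧ (∀ q, OrbitSmoothAt k d₂ d₁ Φ.symm q)

/-- A section `s` of the orbit map is regular if around every point `p`, in some standard chart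
over a neighbourhood of `p`, it has the form `s = f · s₀` near `p` with a smooth map `f` to `T^k`,
where `s₀(r, y) = (√r_1, …, √r_n, 1, y)`. -/
structure IsRegularSection (k d : ℕ) {M : Type*} [TopologicalSpace M]
    [ChartedSpace (EuclideanSpace ℝ (Fin d)) M] [MulAction (Torus k) M]
    (s : OrbitSpace k M → M) : Prop where
  isSection : ∀ p, orbitMk k (s p) = p
  regular : ∀ p, ∃ c : StandardChart k d M, p ∈ c.orbitDomain ∧
    ∃ W : Set (CornerSpace c.n c.m), IsOpen W ∧ c.orbitChart p ∈ W ∧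
    ∃ f : CornerSpace c.n c.m → Torus k,
      ContMDiffOn 𝓘(ℝ, CornerSpace c.n c.m) (torusModel k) ∞ f (corner c.n c.m ∩ W) ∧
      ∀ w ∈ corner c.n c.m ∩ W, s (c.orbitChartInv w) = f w • c.localSection w

open Set Filter Topology

/-! ### Smooth dependence of an integral on its parameter -/

section Calculus

/-! Every point of `M₁` is `t • s₁ p`, so `Ψ` can only be `t • s₁ p ↦ t • s₂ (Φ p)`; this is
uniqueness. Equality of isotropy groups makes the formula well defined
(`equivariantExtension_smul`), and the same construction for `Φ⁻¹` inverts it. What remains is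
smoothness (`contMDiff_equivariantExtension`).

In standard charts, once the smooth torus factors of the regular sections are split off, the map
sends `(z, u, y)` to the standard section at `φ(|z|², y)`, moved by the image of `(phases of z, u)`
under an isomorphism `A` of tori, where `φ` is `Φ` in the induced charts. Phases and square roots
are both singular where coordinates vanish; `CornerIso.contMDiffAt` shows that the singularities
cancel. If `φ_j` vanishes at the point, isotropy at generic nearby points of that wall singles out
one source coordinate `i` whose circle `A` carries onto the `j`-th circle (`CornerIso.exists_wall`).
Then `φ_j = w_i r` with `r` smooth and nonzero at the point (`CornerIso.exists_factor`), so `√φ_j =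
|z_i| √r`. The `j`-th character restricts to the `i`-th circle as the identity or inversion
(`Circle.eq_id_or_inv`), so `|z_i|` and this phase recombine to `z_i` or its conjugate. What is left
of the character is trivial on every circle with vanishing coordinate, hence smooth
(`contMDiffAt_hom_phase`). All other components involve only characters trivial on the isotropy
group and roots of nonzero functions.

The analytic input is Whitney's theorem on even functions, up to the boundary: a smooth function
even in each `p_i` is a smooth function of the `p_i²` (`CornerSpace.IsEven.contDiffOn_comp_sqrt`).
It yields division by a coordinate inside the corner, and smooth transition maps between induced
charts, so that smoothness of `Φ` is available in the charts where the sections are regular. -/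

theorem ContDiff.intervalIntegral_param {E F : Type} [NormedAddCommGroup E] [NormedSpace ℝ E]
    [FiniteDimensional ℝ E] [NormedAddCommGroup F] [NormedSpace ℝ F] [CompleteSpace F]
    {D : E → ℝ → F} (hD : ContDiff ℝ ∞ (Function.uncurry D)) :
    ContDiff ℝ ∞ (fun x => ∫ s in (0 : ℝ)..1, D x s) := by
  rw [contDiff_infty]
  intro n
  induction n generalizing F with
  | zero =>
    rw [Nat.cast_zero, contDiff_zero]
    exact intervalIntegral.continuous_parametric_intervalIntegral_of_continuous'
      hD.continuous 0 1
  | succ n ih =>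
    rw [Nat.cast_succ, contDiff_succ_iff_hasFDerivAt]
    let D' : E → ℝ → (E →L[ℝ] F) := fun x s =>
      (fderiv ℝ (Function.uncurry D) (x, s)).comp (ContinuousLinearMap.inl ℝ E ℝ)
    have hD' : ContDiff ℝ ∞ (Function.uncurry D') := by
      have h1 : ContDiff ℝ ∞ (fderiv ℝ (Function.uncurry D)) :=
        hD.fderiv_right (m := ∞) (by simp)
      exact h1.clm_comp contDiff_const
    refine ⟨fun x => ∫ s in (0 : ℝ)..1, D' x s, ih hD', fun x => ?_⟩
    have hdiff : ∀ x s, HasFDerivAt (fun x => D x s) (D' x s) x := by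
      intro x s
      have h1 : HasFDerivAt (Function.uncurry D) (fderiv ℝ (Function.uncurry D) (x, s)) (x, s) :=
        (hD.differentiable (by simp) (x, s)).hasFDerivAt
      have h2 : HasFDerivAt (fun x : E => (x, s)) (ContinuousLinearMap.inl ℝ E ℝ) x :=
        hasFDerivAt_prodMk_left x s
      exact h1.comp x h2
    have hcD : ∀ x, Continuous (D x) := fun x =>
      hD.continuous.comp (Continuous.prodMk_right x)
    have hcD' : ∀ x, Continuous (D' x) := fun x =>
      hD'.continuous.comp (Continuous.prodMk_right x)
    -- Finite dimension makes the ball compact, so a constant dominates the derivative near `x`.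
    obtain ⟨C, hC⟩ := ((isCompact_closedBall x 1).prod
      (isCompact_Icc (a := (0 : ℝ)) (b := 1))).exists_bound_of_continuousOn
        hD'.continuous.continuousOn
    refine intervalIntegral.hasFDerivAt_integral_of_dominated_of_fderiv_le
      (s := Metric.closedBall x 1) (bound := fun _ => C)
      (Metric.closedBall_mem_nhds x one_pos)
      (Eventually.of_forall fun y => (hcD y).aestronglyMeasurable)
      ((hcD x).intervalIntegrable 0 1) (hcD' x).aestronglyMeasurable
      (Eventually.of_forall fun s hs y hy => ?_) (by simp)
      (Eventually.of_forall fun s _ y _ => hdiff y s)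
    rw [uIoc_of_le zero_le_one] at hs
    exact hC (y, s) ⟨hy, hs.1.le, hs.2⟩

end Calculus

/-! ### Even functions and square roots on the corner -/

namespace CornerSpace

variable {n m : ℕ}

/-- The `i`-th unit vector of the corner directions. -/
noncomputable def unit (i : Fin n) : CornerSpace n m := (Pi.single i 1, 0)

/-- The reflection in the `i`-th corner coordinate. -/
noncomputable def reflect (i : Fin n) (p : CornerSpace n m) : CornerSpace n m :=
  (Function.update p.1 i (-p.1 i), p.2)

/-- Coordinatewise squaring of the corner coordinates. -/
def sq (p : CornerSpace n m) : CornerSpace n m := (fun i => p.1 i ^ 2, p.2)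

/-- Coordinatewise square root of the corner coordinates. -/
noncomputable def sqrt (p : CornerSpace n m) : CornerSpace n m := (fun i => √(p.1 i), p.2)

/-- Even in each corner coordinate. -/
def IsEven {F : Type} (G : CornerSpace n m → F) : Prop := ∀ i p, G (reflect i p) = G p

theorem sq_mem_corner (p : CornerSpace n m) : sq p ∈ corner n m := fun i => sq_nonneg (p.1 i)

theorem sq_sqrt {w : CornerSpace n m} (hw : w ∈ corner n m) : sq (sqrt w) = w :=
  Prod.ext (funext fun i => Real.sq_sqrt (hw i)) rfl

theorem contDiff_sq : ContDiff ℝ ∞ (sq : CornerSpace n m → CornerSpace n m) := by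
  unfold sq; fun_prop

theorem continuous_sqrt : Continuous (sqrt : CornerSpace n m → CornerSpace n m) := by
  unfold sqrt; fun_prop

theorem sq_reflect (i : Fin n) (p : CornerSpace n m) : sq (reflect i p) = sq p := by
  refine Prod.ext (funext fun j => ?_) rfl
  by_cases h : j = i
  · subst h; simp [sq, reflect]
  · simp [sq, reflect, h]

theorem reflect_eq (i : Fin n) (p : CornerSpace n m) :
    reflect i p = p - (2 * p.1 i) • unit i := by
  refine Prod.ext (funext fun j => ?_) (by simp [reflect, unit])
  by_cases h : j = i
  · subst h; simp [reflect, unit]; ring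
  · simp [reflect, unit, h]

theorem reflect_reflect (i : Fin n) (p : CornerSpace n m) : reflect i (reflect i p) = p := by
  simp [reflect]

theorem reflect_unit_self (i : Fin n) : reflect i (unit i : CornerSpace n m) = -unit i := by
  refine Prod.ext (funext fun k => ?_) (by simp [reflect, unit])
  by_cases hk : k = i
  · subst hk; simp [reflect, unit]
  · simp [reflect, unit, hk]

/-- The reflection as a continuous linear map. -/
noncomputable def reflectL (i : Fin n) : CornerSpace n m →L[ℝ] CornerSpace n m :=
  ContinuousLinearMap.id ℝ _ -
    ((2 : ℝ) • ((ContinuousLinearMap.proj i).comp (ContinuousLinearMap.fst ℝ _ _))).smulRight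
      (unit i)

theorem reflectL_apply (i : Fin n) (p : CornerSpace n m) : reflectL i p = reflect i p := by
  rw [reflect_eq]; simp [reflectL]

/-- The complement of a coordinate hyperplane is dense. This lets parity statements be proved after
cancelling a factor `p.1 i`. -/
theorem eq_of_eq_off_wall {F : Type*} [TopologicalSpace F] [T2Space F] (i : Fin n) {f g : CornerSpace n m → F} (hf : Continuous f)
    (hg : Continuous g) (h : ∀ p, p.1 i ≠ 0 → f p = g p) : f = g := by
  funext p
  by_cases hp : p.1 i ≠ 0
  · exact h p hp
  push Not at hp
  have hc : Continuous fun s : ℝ => p + s • (unit i : CornerSpace n m) := by fun_prop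
  have h1 : Tendsto (fun s : ℝ => f (p + s • unit i)) (𝓝[≠] 0) (𝓝 (f p)) := by
    have := (hf.comp hc).tendsto 0
    simp only [Function.comp, zero_smul, add_zero] at this
    exact this.mono_left nhdsWithin_le_nhds
  have h2 : Tendsto (fun s : ℝ => g (p + s • unit i)) (𝓝[≠] 0) (𝓝 (g p)) := by
    have := (hg.comp hc).tendsto 0
    simp only [Function.comp, zero_smul, add_zero] at this
    exact this.mono_left nhdsWithin_le_nhds
  refine tendsto_nhds_unique (h1.congr' ?_) h2
  filter_upwards [self_mem_nhdsWithin] with s hs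
  exact h _ (by simpa [unit, hp] using hs)

variable {F : Type} [NormedAddCommGroup F] [NormedSpace ℝ F]

/-- Hadamard's lemma: the quotient is the integral of the `i`-th partial derivative along the
segment from the wall to `p`. -/
theorem exists_smooth_quotient [CompleteSpace F] (i : Fin n) {G : CornerSpace n m → F}
    (hG : ContDiff ℝ ∞ G) (h0 : ∀ p, p.1 i = 0 → G p = 0) :
    ∃ G₁ : CornerSpace n m → F, ContDiff ℝ ∞ G₁ ∧ ∀ p, G p = p.1 i • G₁ p := by
  -- `sc p s` replaces the coordinate `p.1 i` by `s * p.1 i`.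
  let sc : CornerSpace n m → ℝ → CornerSpace n m := fun p s => p + ((s - 1) * p.1 i) • unit i
  have hsc : ContDiff ℝ ∞ (Function.uncurry sc) := by
    simp only [sc, Function.uncurry_def]; fun_prop
  have hG' : ContDiff ℝ ∞ (fderiv ℝ G) := hG.fderiv_right (m := ∞) (by simp)
  have hD : ContDiff ℝ ∞ (Function.uncurry fun p s => fderiv ℝ G (sc p s) (unit i)) :=
    (hG'.comp hsc).clm_apply contDiff_const
  refine ⟨_, ContDiff.intervalIntegral_param hD, fun p => ?_⟩
  have hder : ∀ s ∈ uIcc (0 : ℝ) 1, HasDerivAt (fun s => G (sc p s))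
      (p.1 i • fderiv ℝ G (sc p s) (unit i)) s := by
    intro s _
    have h1 : HasDerivAt (sc p) (p.1 i • unit i) s := by
      have := ((((hasDerivAt_id s).sub_const 1).mul_const (p.1 i)).smul_const
        (unit i : CornerSpace n m)).const_add p
      simpa [sc] using this
    have h2 := ((hG.differentiable (by simp) (sc p s)).hasFDerivAt).comp_hasDerivAt s h1
    simpa [Function.comp_def] using h2
  have hcont : Continuous fun s => p.1 i • fderiv ℝ G (sc p s) (unit i) :=
    (hD.continuous.comp (Continuous.prodMk_right p)).const_smul (p.1 i)
  have := intervalIntegral.integral_eq_sub_of_hasDerivAt hder (hcont.intervalIntegrable 0 1)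
  rw [intervalIntegral.integral_smul] at this
  rw [this, h0 (sc p 0) (by simp [sc, unit])]
  simp [sc]

theorem corner_eq_prod : corner n m = (Set.pi univ fun _ : Fin n => Ici (0 : ℝ)) ×ˢ univ := by
  ext w; simp [corner, Pi.le_def]

theorem closure_interior_corner :
    closure ((Set.pi univ fun _ : Fin n => Ioi (0 : ℝ)) ×ˢ (univ : Set (Fin m → ℝ))) =
      corner n m := by
  rw [closure_prod_eq, closure_pi_set, corner_eq_prod]; simp

theorem isOpen_positive :
    IsOpen ((Set.pi univ fun _ : Fin n => Ioi (0 : ℝ)) ×ˢ (univ : Set (Fin m → ℝ))) :=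
  (isOpen_set_pi finite_univ fun _ _ => isOpen_Ioi).prod isOpen_univ

theorem convex_positive :
    Convex ℝ ((Set.pi univ fun _ : Fin n => Ioi (0 : ℝ)) ×ˢ (univ : Set (Fin m → ℝ))) :=
  (convex_pi fun _ _ => convex_Ioi 0).prod convex_univ

theorem uniqueDiffOn_corner : UniqueDiffOn ℝ (corner n m) := by
  rw [corner_eq_prod]
  exact (UniqueDiffOn.univ_pi fun _ => uniqueDiffOn_Ici 0).prod uniqueDiffOn_univ

theorem fderiv_reflect {G : CornerSpace n m → F} (hG : ContDiff ℝ ∞ G) (he : IsEven G)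
    (i : Fin n) (p v : CornerSpace n m) :
    fderiv ℝ G (reflect i p) v = fderiv ℝ G p (reflect i v) := by
  have h1 : HasFDerivAt (fun q => G (reflectL i q))
      ((fderiv ℝ G (reflectL i p)).comp (reflectL i)) p :=
    ((hG.differentiable (by simp) _).hasFDerivAt).comp p (reflectL i).hasFDerivAt
  have h2 : (fun q => G (reflectL i q)) = G := by
    funext q; rw [reflectL_apply]; exact he i q
  rw [h2] at h1
  have h3 := h1.fderiv
  rw [h3, ContinuousLinearMap.comp_apply, reflectL_apply, reflectL_apply, reflect_reflect]

theorem hasFDerivAt_sqrt {w : CornerSpace n m} (hw : ∀ i, 0 < w.1 i) :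
    HasFDerivAt sqrt ((ContinuousLinearMap.pi fun i : Fin n =>
      (1 / (2 * √(w.1 i))) • (ContinuousLinearMap.proj i).comp
        (ContinuousLinearMap.fst ℝ (Fin n → ℝ) (Fin m → ℝ))).prod
          (ContinuousLinearMap.snd ℝ (Fin n → ℝ) (Fin m → ℝ))) w := by
  refine HasFDerivAt.prodMk (hasFDerivAt_pi.2 fun i => ?_) hasFDerivAt_snd
  have h : HasFDerivAt (fun w : CornerSpace n m => w.1 i) ((ContinuousLinearMap.proj i).comp
        (ContinuousLinearMap.fst ℝ (Fin n → ℝ) (Fin m → ℝ))) w :=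
    ((ContinuousLinearMap.proj i).comp
        (ContinuousLinearMap.fst ℝ (Fin n → ℝ) (Fin m → ℝ))).hasFDerivAt
  exact h.sqrt (hw i).ne'

theorem eq_sum_unit (v : CornerSpace n m) : v = ∑ i, v.1 i • unit i + (0, v.2) := by
  refine Prod.ext ?_ ?_
  · simp only [Prod.fst_add, Prod.fst_sum, Prod.smul_fst, unit, add_zero]
    funext j
    simp [Finset.sum_apply, Pi.single_apply]
  · simp [Prod.snd_sum, unit]

/-- The partial derivative `∂ᵢG` is odd in `pᵢ`, so `∂ᵢG = pᵢ Bᵢ` with `Bᵢ` smooth and even. In the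
chain rule the factor `1 / (2√wᵢ)` then cancels, leaving `Bᵢ(√w) / 2`. The derivative is thus again
an even smooth function of `√w`, which is what an induction on the order of differentiability needs.
-/
theorem IsEven.exists_fderiv [CompleteSpace F] {G : CornerSpace n m → F} (hG : ContDiff ℝ ∞ G)
    (he : IsEven G) : ∃ A : CornerSpace n m → (CornerSpace n m →L[ℝ] F), ContDiff ℝ ∞ A ∧
      IsEven A ∧ ∀ w ∈ corner n m,
        HasFDerivWithinAt (fun w => G (sqrt w)) (A (sqrt w)) (corner n m) w := by
  have hG' : ContDiff ℝ ∞ (fderiv ℝ G) := hG.fderiv_right (m := ∞) (by simp)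
  have hB : ∀ i : Fin n, ∃ B : CornerSpace n m → F, ContDiff ℝ ∞ B ∧
      ∀ p, fderiv ℝ G p (unit i) = p.1 i • B p := by
    intro i
    refine exists_smooth_quotient i (hG'.clm_apply contDiff_const) fun p hp => ?_
    have h := fderiv_reflect hG he i p (unit i)
    have h1 : reflect i p = p := by rw [reflect_eq, hp]; simp
    rw [h1, reflect_unit_self, map_neg] at h
    have h2 : (2 : ℝ) • fderiv ℝ G p (unit i) = 0 := by
      rw [two_smul]; exact eq_neg_iff_add_eq_zero.mp h
    exact (smul_eq_zero.mp h2).resolve_left two_ne_zero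
  choose B hBs hBe using hB
  have hBeven : ∀ i, IsEven (B i) := by
    intro i j p
    have hc : Continuous (reflect j : CornerSpace n m → CornerSpace n m) := by
      have : (reflect j : CornerSpace n m → CornerSpace n m) = reflectL j :=
        funext fun q => (reflectL_apply j q).symm
      rw [this]; exact (reflectL j).continuous
    refine congrFun (eq_of_eq_off_wall i ((hBs i).continuous.comp hc) (hBs i).continuous ?_) p
    intro q hq
    have h := fderiv_reflect hG he j q (unit i)
    rw [hBe i (reflect j q)] at h
    by_cases hij : i = j
    · subst hij
      rw [reflect_unit_self, map_neg, hBe i q] at h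
      simp only [reflect, Function.update_self, neg_smul, neg_inj] at h
      exact smul_right_injective F hq h
    · have h2 : reflect j (unit i : CornerSpace n m) = unit i := by
        rw [reflect_eq]; simp [unit, Ne.symm hij]
      rw [h2, hBe i q] at h
      simp only [reflect, Function.update_of_ne hij] at h
      exact smul_right_injective F hq h
  let S : CornerSpace n m →L[ℝ] CornerSpace n m :=
    (ContinuousLinearMap.inr ℝ _ _).comp (ContinuousLinearMap.snd ℝ (Fin n → ℝ) (Fin m → ℝ))
  let pr : Fin n → (CornerSpace n m →L[ℝ] ℝ) := fun i => (ContinuousLinearMap.proj i).comp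
        (ContinuousLinearMap.fst ℝ (Fin n → ℝ) (Fin m → ℝ))
  let A : CornerSpace n m → (CornerSpace n m →L[ℝ] F) := fun p =>
    ∑ i, ((1 / 2 : ℝ) • pr i).smulRight (B i p) + (fderiv ℝ G p).comp S
  have hA : ContDiff ℝ ∞ A := by
    refine ContDiff.add (ContDiff.sum fun i _ => ?_) (hG'.clm_comp contDiff_const)
    exact contDiff_const.smulRight (hBs i)
  refine ⟨A, hA, fun j p => ?_, fun w hw => ?_⟩
  · refine ContinuousLinearMap.ext fun v => ?_
    have h2 : reflect j (S v) = S v := by simp [reflect_eq, S]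
    simp only [A, add_apply, sum_apply,
      ContinuousLinearMap.smulRight_apply, ContinuousLinearMap.comp_apply, fderiv_reflect hG he,
      hBeven _ j p, h2]
  rw [← closure_interior_corner] at hw ⊢
  have hint : ∀ w ∈ ((Set.pi univ fun _ : Fin n => Ioi (0 : ℝ)) ×ˢ (univ : Set (Fin m → ℝ))),
      HasFDerivAt (fun w => G (sqrt w)) (A (sqrt w)) w := by
    intro w hw
    have hw' : ∀ i, 0 < w.1 i := fun i => hw.1 i (mem_univ i)
    have h := ((hG.differentiable (by simp) (sqrt w)).hasFDerivAt).comp w (hasFDerivAt_sqrt hw')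
    refine h.congr_fderiv ?_
    refine ContinuousLinearMap.ext fun v => ?_
    rw [ContinuousLinearMap.comp_apply, eq_sum_unit (ContinuousLinearMap.prod _ _ v), map_add,
      map_sum]
    simp only [map_smul, hBe, A, add_apply, sum_apply,
      ContinuousLinearMap.smulRight_apply, ContinuousLinearMap.comp_apply]
    congr 1
    refine Finset.sum_congr rfl fun i _ => ?_
    have : √(w.1 i) ≠ 0 := (Real.sqrt_pos.2 (hw' i)).ne'
    simp only [sqrt, smul_smul, ContinuousLinearMap.prod_apply, ContinuousLinearMap.coe_pi',
      smul_apply, ContinuousLinearMap.comp_apply, smul_eq_mul, pr]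
    congr 1
    field_simp
  -- On the boundary the chain rule fails, as the square root is not differentiable at `0`; but the
  -- derivative found on the convex open interior extends continuously.
  refine hasFDerivWithinAt_closure_of_tendsto_fderiv
    (fun w hw => (hint w hw).differentiableAt.differentiableWithinAt) convex_positive
    isOpen_positive (fun y _ => (hG.continuous.comp continuous_sqrt).continuousWithinAt) ?_
  have h1 : Tendsto (fun w => A (sqrt w)) (𝓝[((Set.pi univ fun _ : Fin n => Ioi (0 : ℝ)) ×ˢ
      (univ : Set (Fin m → ℝ)))] w) (𝓝 (A (sqrt w))) :=
    ((hA.continuous.comp continuous_sqrt).tendsto w).mono_left nhdsWithin_le_nhds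
  refine h1.congr' ?_
  filter_upwards [self_mem_nhdsWithin] with y hy
  exact (hint y hy).fderiv.symm

/-- Whitney's theorem, by induction on the order. The target space varies because the derivative
takes values in linear maps. -/
theorem IsEven.contDiffOn_comp_sqrt [CompleteSpace F] {G : CornerSpace n m → F}
    (hG : ContDiff ℝ ∞ G) (he : IsEven G) :
    ContDiffOn ℝ ∞ (fun w => G (sqrt w)) (corner n m) := by
  rw [contDiffOn_infty]
  intro N
  induction N generalizing F with
  | zero =>
    rw [Nat.cast_zero, contDiffOn_zero]
    exact (hG.continuous.comp continuous_sqrt).continuousOn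
  | succ N ih =>
    obtain ⟨A, hA, hAe, hd⟩ := IsEven.exists_fderiv hG he
    rw [Nat.cast_succ, contDiffOn_succ_iff_hasFDerivWithinAt_of_uniqueDiffOn uniqueDiffOn_corner]
    exact ⟨by simp, fun w => A (sqrt w), ih hA hAe, hd⟩

end CornerSpace

/-! ### Germs of smooth functions on the corner -/

namespace CornerSpace

variable {n m : ℕ} {F : Type} [NormedAddCommGroup F] [NormedSpace ℝ F]

/-- Smoothness in the corner in a neighbourhood of a point. -/
def SmoothNear (f : CornerSpace n m → F) (w₀ : CornerSpace n m) : Prop :=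
  ∃ W : Set (CornerSpace n m), IsOpen W ∧ w₀ ∈ W ∧ ContDiffOn ℝ ∞ f (corner n m ∩ W)

theorem SmoothNear.congr {f g : CornerSpace n m → F} {w₀ : CornerSpace n m} (hf : SmoothNear f w₀)
    (h : ∀ᶠ w in 𝓝[corner n m] w₀, g w = f w) : SmoothNear g w₀ := by
  obtain ⟨W, hW, hw, hfW⟩ := hf
  obtain ⟨V, hVg, hV, hwV⟩ := eventually_nhds_iff.1 (eventually_nhdsWithin_iff.1 h)
  exact ⟨W ∩ V, hW.inter hV, ⟨hw, hwV⟩, (hfW.mono fun w hw => ⟨hw.1, hw.2.1⟩).congr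
    fun w hw => hVg w hw.2.2 hw.1⟩

theorem SmoothNear.continuousWithinAt {f : CornerSpace n m → F} {w₀ : CornerSpace n m}
    (hf : SmoothNear f w₀) (hw₀ : w₀ ∈ corner n m) : ContinuousWithinAt f (corner n m) w₀ := by
  obtain ⟨W, hW, hw, hfW⟩ := hf
  exact (hfW.continuousOn w₀ ⟨hw₀, hw⟩).mono_of_mem_nhdsWithin
    (inter_mem_nhdsWithin _ (hW.mem_nhds hw))

theorem SmoothNear.tendsto {n' m' : ℕ} {f : CornerSpace n m → CornerSpace n' m'}
    {w₀ : CornerSpace n m} (hf : SmoothNear f w₀) (hw₀ : w₀ ∈ corner n m)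
    (hc : ∀ w ∈ corner n m, f w ∈ corner n' m') :
    Tendsto f (𝓝[corner n m] w₀) (𝓝[corner n' m'] (f w₀)) :=
  tendsto_nhdsWithin_of_tendsto_nhds_of_eventually_within _ (hf.continuousWithinAt hw₀)
    (eventually_mem_nhdsWithin.mono hc)

theorem SmoothNear.comp {n' m' : ℕ} {g : CornerSpace n' m' → F}
    {f : CornerSpace n m → CornerSpace n' m'} {w₀ : CornerSpace n m}
    (hg : SmoothNear g (f w₀)) (hf : SmoothNear f w₀) (hw₀ : w₀ ∈ corner n m)
    (hc : ∀ w ∈ corner n m, f w ∈ corner n' m') : SmoothNear (fun w => g (f w)) w₀ := by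
  have ht := hf.tendsto hw₀ hc
  obtain ⟨W, hW, hw, hfW⟩ := hf
  obtain ⟨V, hV, hwV, hgV⟩ := hg
  obtain ⟨U, hUV, hU, hwU⟩ := eventually_nhds_iff.1 (eventually_nhdsWithin_iff.1
    (ht.eventually (mem_nhdsWithin_of_mem_nhds (hV.mem_nhds hwV))))
  exact ⟨W ∩ U, hW.inter hU, ⟨hw, hwU⟩, hgV.comp (hfW.mono fun w hw => ⟨hw.1, hw.2.1⟩)
    fun w hw => ⟨hc w hw.1, hUV w hw.2.2 hw.1⟩⟩

theorem contMDiffAt_comp_of_contMDiffOn_corner {E₀ H₀ N E₁ H₁ X : Type*}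
    [NormedAddCommGroup E₀] [NormedSpace ℝ E₀] [TopologicalSpace H₀]
    {I₀ : ModelWithCorners ℝ E₀ H₀} [TopologicalSpace N] [ChartedSpace H₀ N]
    [NormedAddCommGroup E₁] [NormedSpace ℝ E₁] [TopologicalSpace H₁]
    {I₁ : ModelWithCorners ℝ E₁ H₁} [TopologicalSpace X] [ChartedSpace H₁ X]
    {f : CornerSpace n m → N} {W : Set (CornerSpace n m)} (hW : IsOpen W)
    (hf : ContMDiffOn 𝓘(ℝ, CornerSpace n m) I₀ ∞ f (corner n m ∩ W))
    {q : X → CornerSpace n m} {x : X} (hq : ContMDiffAt I₁ 𝓘(ℝ, CornerSpace n m) ∞ q x)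
    (hc : ∀ x, q x ∈ corner n m) (hx : q x ∈ W) : ContMDiffAt I₁ I₀ ∞ (fun x => f (q x)) x := by
  have h := (hf (q x) ⟨hc x, hx⟩).comp (s := q ⁻¹' W) x hq.contMDiffWithinAt
    fun y hy => ⟨hc y, hy⟩
  exact h.contMDiffAt (hq.continuousAt (hW.mem_nhds hx))

theorem SmoothNear.contMDiffAt_comp {E₁ H₁ X : Type*}
    [NormedAddCommGroup E₁] [NormedSpace ℝ E₁] [TopologicalSpace H₁]
    {I₁ : ModelWithCorners ℝ E₁ H₁} [TopologicalSpace X] [ChartedSpace H₁ X]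
    {f : CornerSpace n m → F} {q : X → CornerSpace n m} {x : X} (hf : SmoothNear f (q x))
    (hq : ContMDiffAt I₁ 𝓘(ℝ, CornerSpace n m) ∞ q x)
    (hc : ∀ x, q x ∈ corner n m) : ContMDiffAt I₁ 𝓘(ℝ, F) ∞ (fun x => f (q x)) x := by
  obtain ⟨W, hW, hw, hfW⟩ := hf
  exact contMDiffAt_comp_of_contMDiffOn_corner hW hfW.contMDiffOn hq hc hw

theorem exists_bump {W : Set (CornerSpace n m)} {w₀ : CornerSpace n m} (hW : IsOpen W)
    (hw₀ : w₀ ∈ W) : ∃ χ : CornerSpace n m → ℝ, ContDiff ℝ ∞ χ ∧ tsupport χ ⊆ W ∧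
      ∃ V : Set (CornerSpace n m), IsOpen V ∧ w₀ ∈ V ∧ ∀ w ∈ V, χ w = 1 := by
  obtain ⟨r, hr, hrW⟩ := Metric.nhds_basis_closedBall.mem_iff.1 (hW.mem_nhds hw₀)
  let χ : ContDiffBump w₀ := ⟨r / 2, r, half_pos hr, half_lt_self hr⟩
  exact ⟨χ, χ.contDiff, χ.tsupport_eq.trans_subset hrW, Metric.ball w₀ (r / 2),
    Metric.isOpen_ball, Metric.mem_ball_self (half_pos hr),
    fun w hw => χ.one_of_mem_closedBall (Metric.ball_subset_closedBall hw)⟩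

/-- A local form of Whitney's theorem: the cutoff `χ ∘ sq` is itself even, so multiplying by it
globalizes `G` without losing parity. -/
theorem smoothNear_comp_sqrt [CompleteSpace F] {G : CornerSpace n m → F}
    {W : Set (CornerSpace n m)} {w₀ : CornerSpace n m} (hW : IsOpen W) (hw₀ : w₀ ∈ W)
    (hG : ∀ p, sq p ∈ W → ContDiffAt ℝ ∞ G p)
    (he : ∀ i p, sq p ∈ W → G (reflect i p) = G p) :
    SmoothNear (fun w => G (sqrt w)) w₀ := by
  obtain ⟨χ, hχ, hsupp, V, hV, hwV, hχ1⟩ := exists_bump hW hw₀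
  have hsm : ContDiff ℝ ∞ fun p => χ (sq p) • G p := by
    rw [contDiff_iff_contDiffAt]
    intro p
    by_cases hp : sq p ∈ W
    · exact (hχ.comp contDiff_sq).contDiffAt.smul (hG p hp)
    · have h0 : ∀ᶠ q in 𝓝 p, χ (sq q) = 0 :=
        contDiff_sq.continuous.continuousAt.eventually
          (notMem_tsupport_iff_eventuallyEq.1 fun h => hp (hsupp h))
      refine (contDiffAt_const (c := (0 : F))).congr_of_eventuallyEq ?_
      filter_upwards [h0] with q hq
      rw [hq, zero_smul]
  have hev : IsEven fun p => χ (sq p) • G p := by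
    intro i p
    simp only [sq_reflect]
    by_cases hp : sq p ∈ W
    · rw [he i p hp]
    · rw [image_eq_zero_of_notMem_tsupport fun h => hp (hsupp h), zero_smul, zero_smul]
  refine ⟨V, hV, hwV, ((hev.contDiffOn_comp_sqrt hsm).mono inter_subset_left).congr ?_⟩
  intro w hw
  simp [sq_sqrt hw.1, hχ1 w hw.2]

/-- Pulled back by squaring and cut off, `f` becomes globally smooth and even, and vanishes at `pᵢ =
0`. Its quotient by `pᵢ` is odd in `pᵢ`, so it vanishes there too and can be divided again. The
quotient by `pᵢ²` is even and descends to the corner by Whitney's theorem. -/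
theorem SmoothNear.exists_quotient {f : CornerSpace n m → ℝ} {w₀ : CornerSpace n m}
    (hf : SmoothNear f w₀) (i : Fin n)
    (h0 : ∀ᶠ w in 𝓝[corner n m] w₀, w.1 i = 0 → f w = 0) :
    ∃ h : CornerSpace n m → ℝ, SmoothNear h w₀ ∧
      ∀ᶠ w in 𝓝[corner n m] w₀, f w = w.1 i * h w := by
  obtain ⟨W, hW, hw, hfW⟩ := hf
  obtain ⟨U, hU0, hU, hwU⟩ := eventually_nhds_iff.1 (eventually_nhdsWithin_iff.1 h0)
  obtain ⟨χ, hχ, hsupp, V, hV, hwV, hχ1⟩ := exists_bump (hW.inter hU) ⟨hw, hwU⟩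
  have hg : ContDiffOn ℝ ∞ (fun w => χ w * f w) (corner n m) := by
    intro w hwc
    by_cases hwW : w ∈ W ∩ U
    · exact (hχ.contDiffAt.contDiffWithinAt).mul ((hfW w ⟨hwc, hwW.1⟩).mono_of_mem_nhdsWithin
        (inter_mem_nhdsWithin _ (hW.mem_nhds hwW.1)))
    · have h0 : ∀ᶠ q in 𝓝 w, χ q = 0 :=
        notMem_tsupport_iff_eventuallyEq.1 fun h => hwW (hsupp h)
      refine ((contDiffAt_const (c := (0 : ℝ))).congr_of_eventuallyEq ?_).contDiffWithinAt
      filter_upwards [h0] with q hq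
      rw [hq, zero_mul]
  have hg0 : ∀ w ∈ corner n m, w.1 i = 0 → χ w * f w = 0 := by
    intro w hwc hwi
    by_cases hwW : w ∈ W ∩ U
    · rw [hU0 w hwW.2 hwc hwi, mul_zero]
    · rw [image_eq_zero_of_notMem_tsupport fun h => hwW (hsupp h), zero_mul]
  set g := fun w => χ w * f w with hgdef
  have hG : ContDiff ℝ ∞ fun p => g (sq p) := hg.comp_contDiff contDiff_sq sq_mem_corner
  obtain ⟨G₁, hG₁, he₁⟩ := exists_smooth_quotient i hG fun p hp =>
    hg0 _ (sq_mem_corner p) (by simp [sq, hp])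
  have hcr : ∀ j, Continuous (reflect j : CornerSpace n m → CornerSpace n m) := fun j => by
    have : (reflect j : CornerSpace n m → CornerSpace n m) = reflectL j :=
      funext fun q => (reflectL_apply j q).symm
    rw [this]; exact (reflectL j).continuous
  have hodd : ∀ p, G₁ (reflect i p) = -G₁ p := by
    refine congrFun (eq_of_eq_off_wall i (hG₁.continuous.comp (hcr i)) hG₁.continuous.neg ?_)
    intro p hp
    have h1 := he₁ (reflect i p)
    simp only [sq_reflect, he₁ p] at h1
    simp only [reflect, Function.update_self, smul_eq_mul, neg_mul] at h1
    have h2 : p.1 i * (G₁ p + G₁ (reflect i p)) = 0 := by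
      simp only [reflect]; linarith
    change G₁ (reflect i p) = -G₁ p
    linarith [(mul_eq_zero.1 h2).resolve_left hp]
  obtain ⟨G₂, hG₂, he₂⟩ := exists_smooth_quotient i hG₁ fun p hp => by
    have h1 : reflect i p = p := by rw [reflect_eq, hp]; simp
    have := hodd p
    rw [h1] at this
    linarith
  have he : ∀ p, g (sq p) = p.1 i ^ 2 * G₂ p := fun p => by
    rw [he₁ p, he₂ p]; simp only [smul_eq_mul]; ring
  have heven : IsEven G₂ := by
    intro j
    refine congrFun (eq_of_eq_off_wall i (hG₂.continuous.comp (hcr j)) hG₂.continuous ?_)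
    intro p hp
    have h1 := he (reflect j p)
    rw [sq_reflect, he p] at h1
    have h2 : (reflect j p).1 i ^ 2 = p.1 i ^ 2 := congrFun (congrArg Prod.fst (sq_reflect j p)) i
    rw [h2] at h1
    exact (mul_left_cancel₀ (pow_ne_zero 2 hp) h1).symm
  refine ⟨fun w => G₂ (sqrt w), ⟨univ, isOpen_univ, mem_univ _, by
    rw [inter_univ]; exact heven.contDiffOn_comp_sqrt hG₂⟩, ?_⟩
  filter_upwards [self_mem_nhdsWithin, mem_nhdsWithin_of_mem_nhds (hV.mem_nhds hwV)] with w hwc hwV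
  have h1 := he (sqrt w)
  rw [sq_sqrt hwc] at h1
  simp only [hgdef, hχ1 w hwV, one_mul] at h1
  rw [h1]
  simp [sqrt, Real.sq_sqrt (hwc i)]

end CornerSpace

/-! ### Smooth maps into the circle and the torus -/

section TorusSmooth

variable {E H X : Type*} [NormedAddCommGroup E] [NormedSpace ℝ E] [TopologicalSpace H]
  {I : ModelWithCorners ℝ E H} [TopologicalSpace X] [ChartedSpace H X]

theorem contMDiffAt_torus_iff {k : ℕ} {f : X → Torus k} {x : X} :
    ContMDiffAt I (torusModel k) ∞ f x ↔ ∀ i, ContMDiffAt I (𝓡 1) ∞ (fun y => f y i) x := by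
  rw [contMDiffAt_iff_target]
  have h1 : ∀ i, ContMDiffAt I (𝓡 1) ∞ (fun y => f y i) x ↔ ContinuousAt (fun y => f y i) x ∧
      ContMDiffAt I 𝓘(ℝ, EuclideanSpace ℝ (Fin 1)) ∞
        (extChartAt (𝓡 1) (f x i) ∘ fun y => f y i) x := fun i => contMDiffAt_iff_target
  simp only [h1, forall_and, continuousAt_pi]
  exact and_congr_right fun _ => contMDiffAt_pi_space

theorem contMDiffAt_circle_of_coe {f : X → Circle} {x : X}
    (hf : ContMDiffAt I 𝓘(ℝ, ℂ) ∞ (fun y => (f y : ℂ)) x) : ContMDiffAt I (𝓡 1) ∞ f x := by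
  have hg : ContDiffAt ℝ ∞ (fun z : ℂ => (Complex.log (star (f x : ℂ) * z)).im) (f x : ℂ) := by
    have h0 : star (f x : ℂ) * (f x : ℂ) = 1 := by
      have := Complex.normSq_eq_conj_mul_self (z := (f x : ℂ))
      rw [Circle.normSq_coe] at this
      exact_mod_cast this.symm
    have h1 : ContDiffAt ℝ ∞ Complex.log (star (f x : ℂ) * (f x : ℂ)) :=
      (Complex.contDiffAt_log (by rw [h0]; exact Complex.one_mem_slitPlane)).restrict_scalars ℝ
    exact Complex.imCLM.contDiff.contDiffAt.comp _ (h1.comp _ (by fun_prop))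
  -- This expression equals `f y` for every `y`, as `exp (i arg u) = u` on the circle; only its
  -- smoothness is local, the argument of the logarithm being `1` at `x`.
  have h2 : ContMDiffAt I (𝓡 1) ∞
      (fun y => f x * Circle.exp (Complex.log (star (f x : ℂ) * f y)).im) x :=
    contMDiffAt_const.mul (contMDiff_circleExp.contMDiffAt.comp x
      (ContMDiffAt.comp (g := fun z : ℂ => (Complex.log (star (f x : ℂ) * z)).im) x
        hg.contMDiffAt hf))
  refine h2.congr_of_eventuallyEq (Eventually.of_forall fun y => ?_)
  have h3 : star (f x : ℂ) * (f y : ℂ) = (((f x)⁻¹ * f y : Circle) : ℂ) := by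
    rw [Circle.coe_mul, Circle.coe_inv_eq_conj]; rfl
  simp only [h3, Complex.log_im, Circle.exp_arg, mul_inv_cancel_left]

theorem contMDiff_circle_coe : ContMDiff (𝓡 1) 𝓘(ℝ, ℂ) ∞ (fun z : Circle => (z : ℂ)) :=
  haveI : Fact (Module.finrank ℝ ℂ = 1 + 1) := finrank_real_complex_fact'
  contMDiff_coe_sphere

/-- The phase of a complex number, with phase `1` at `0`. -/
noncomputable def Complex.phase (z : ℂ) : Circle := Circle.exp z.arg

theorem Complex.norm_mul_phase (z : ℂ) : (‖z‖ : ℂ) * z.phase = z := by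
  rw [phase, Circle.coe_exp, norm_mul_exp_arg_mul_I]

theorem ContMDiffAt.phase {g : X → ℂ} {x : X} (hg : ContMDiffAt I 𝓘(ℝ, ℂ) ∞ g x)
    (hx : g x ≠ 0) : ContMDiffAt I (𝓡 1) ∞ (fun y => (g y).phase) x := by
  refine contMDiffAt_circle_of_coe ?_
  have h1 : ContDiffAt ℝ ∞ (fun z : ℂ => ((‖z‖⁻¹ : ℝ) : ℂ) * z) (g x) :=
    (Complex.ofRealCLM.contDiff.contDiffAt.comp _
      ((contDiffAt_norm ℝ hx).inv (norm_ne_zero_iff.2 hx))).mul contDiffAt_id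
  refine (h1.contMDiffAt.comp x hg).congr_of_eventuallyEq ?_
  filter_upwards [hg.continuousAt.eventually_ne hx] with y hy
  have h2 : (‖g y‖ : ℂ) ≠ 0 := by exact_mod_cast norm_ne_zero_iff.2 hy
  have h3 := Complex.norm_mul_phase (g y)
  simp only [Function.comp]
  nth_rewrite 3 [← h3]
  rw [← mul_assoc, Complex.ofReal_inv, inv_mul_cancel₀ h2, one_mul]

theorem ContMDiffAt.circle_zpow {g : X → Circle} {x : X} (hg : ContMDiffAt I (𝓡 1) ∞ g x)
    (a : ℤ) : ContMDiffAt I (𝓡 1) ∞ (fun y => g y ^ a) x := by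
  cases a with
  | ofNat a => simpa using hg.pow a
  | negSucc a => simpa [zpow_negSucc] using (hg.pow (a + 1)).inv

theorem ContMDiffAt.torus_mul {k : ℕ} {f g : X → Torus k} {x : X}
    (hf : ContMDiffAt I (torusModel k) ∞ f x) (hg : ContMDiffAt I (torusModel k) ∞ g x) :
    ContMDiffAt I (torusModel k) ∞ (fun y => f y * g y) x :=
  contMDiffAt_torus_iff.2 fun i =>
    (contMDiffAt_torus_iff.1 hf i).mul (contMDiffAt_torus_iff.1 hg i)

theorem ContMDiffAt.torus_inv {k : ℕ} {f : X → Torus k} {x : X}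
    (hf : ContMDiffAt I (torusModel k) ∞ f x) :
    ContMDiffAt I (torusModel k) ∞ (fun y => (f y)⁻¹) x :=
  contMDiffAt_torus_iff.2 fun i => (contMDiffAt_torus_iff.1 hf i).inv

end TorusSmooth

/-! ### Characters of circles and tori -/

section Characters

/-- The lift of `χ ∘ exp` to the real line is additive by uniqueness of lifts, hence linear by
continuity, and its slope is an integer because it sends `2π` into `2πℤ`. -/
theorem Circle.exists_eq_zpow {χ : Circle →* Circle} (hχ : Continuous χ) :
    ∃ a : ℤ, ∀ z, χ z = z ^ a := by
  obtain ⟨g, ⟨hg0, hg⟩, -⟩ := Circle.isCoveringMap_exp.existsUnique_continuousMap_lifts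
    ⟨fun t : ℝ => χ (Circle.exp t), hχ.comp Circle.exp.continuous⟩ 0 0 (by simp)
  have hg' : ∀ t, Circle.exp (g t) = χ (Circle.exp t) := fun t => congrFun hg t
  have hadd : ∀ s t, g (s + t) = g s + g t := by
    intro s
    refine congrFun (Circle.isCoveringMap_exp.eq_of_comp_eq (by fun_prop) (by fun_prop)
      (funext fun t => ?_) 0 (by simp [hg0]))
    simp only [Function.comp, hg', Circle.exp_add, map_mul]
  have hlin : ∀ t : ℝ, g t = t * g 1 := fun t => by
    simpa using map_real_smul (AddMonoidHom.mk' g hadd) g.continuous t (1 : ℝ)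
  have h1 : Circle.exp (g (2 * Real.pi)) = 1 := by rw [hg', Circle.exp_two_pi, map_one]
  obtain ⟨a, ha⟩ := Circle.exp_eq_one.1 h1
  have hga : g 1 = a := by
    rw [hlin, mul_comm] at ha
    exact mul_right_cancel₀ Real.two_pi_pos.ne' ha
  refine ⟨a, fun z => ?_⟩
  obtain ⟨t, rfl⟩ := Circle.exp_surjective z
  rw [← hg', hlin, hga, mul_comm, ← zsmul_eq_mul, Circle.exp_zsmul]

theorem Circle.eq_id_or_inv {χ : Circle →* Circle} (hχ : Continuous χ)
    (hinj : Function.Injective χ) : (∀ z, χ z = z) ∨ ∀ z, χ z = z⁻¹ := by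
  obtain ⟨a, ha⟩ := Circle.exists_eq_zpow hχ
  have hker : ∀ z : Circle, z ^ a = 1 → z = 1 := fun z hz => by
    rw [← ha] at hz; exact hinj (hz.trans (map_one χ).symm)
  have ha0 : a ≠ 0 := by
    rintro rfl
    have h := hker (Circle.exp Real.pi) (zpow_zero _)
    obtain ⟨n, hn⟩ := Circle.exp_eq_one.1 h
    have h2 : (1 : ℝ) = n * 2 := by
      have := Real.pi_pos
      have h3 : Real.pi * 1 = Real.pi * (n * 2) := by linarith
      exact mul_left_cancel₀ this.ne' h3
    have h3 : (1 : ℤ) = n * 2 := by exact_mod_cast h2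
    omega
  -- A primitive `|a|`-th root of unity lies in the kernel, which forces `a = ±1`.
  have h := hker (Circle.exp (2 * Real.pi / a)) (by
    rw [← Circle.exp_zsmul, zsmul_eq_mul, mul_div_cancel₀ _ (by exact_mod_cast ha0),
      Circle.exp_two_pi])
  obtain ⟨n, hn⟩ := Circle.exp_eq_one.1 h
  have ha0' : (a : ℝ) ≠ 0 := by exact_mod_cast ha0
  have h2 : (1 : ℝ) = n * a := by
    rw [div_eq_iff ha0'] at hn
    refine mul_left_cancel₀ Real.two_pi_pos.ne' (by linarith)
  have h3 : n * a = 1 := by exact_mod_cast h2.symm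
  rcases Int.eq_one_or_neg_one_of_mul_eq_one' h3 with h | h
  · exact Or.inl fun z => by rw [ha, h.2, zpow_one]
  · exact Or.inr fun z => by rw [ha, h.2, zpow_neg_one]

theorem torus_hom_eq_prod {n l : ℕ} (χ : Torus n × Torus l →* Circle) (t : Torus n)
    (u : Torus l) : χ (t, u) =
      (∏ i, χ (Pi.mulSingle i (t i), 1)) * ∏ i, χ (1, Pi.mulSingle i (u i)) := by
  have h1 : (t, u) = (t, 1) * (1, u) := by simp
  have h2 : χ (t, 1) = ∏ i, χ (Pi.mulSingle i (t i), 1) := by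
    have := map_prod (χ.comp (MonoidHom.inl _ _)) (fun i => Pi.mulSingle i (t i)) Finset.univ
    rw [Finset.univ_prod_mulSingle] at this
    exact this
  have h3 : χ (1, u) = ∏ i, χ (1, Pi.mulSingle i (u i)) := by
    have := map_prod (χ.comp (MonoidHom.inr _ _)) (fun i => Pi.mulSingle i (u i)) Finset.univ
    rw [Finset.univ_prod_mulSingle] at this
    exact this
  rw [h1, map_mul, h2, h3]

theorem continuous_mulSingle_circle {n : ℕ} (i : Fin n) :
    Continuous fun z : Circle => (Pi.mulSingle i z : Torus n) :=
  continuous_mulSingle (A := fun _ : Fin n => Circle) i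

/-- A character is a product of integer powers of the coordinates. The phase of `x.1 i` is singular
only where that coordinate vanishes, and there the hypothesis makes its factor constant. -/
theorem contMDiffAt_hom_phase {n l m : ℕ} {χ : Torus n × Torus l →* Circle}
    (hχ : Continuous χ) {x : StdSpace n l m}
    (h : ∀ i, x.1 i = 0 → ∀ z, χ (Pi.mulSingle i z, 1) = 1) :
    ContMDiffAt (stdModel n l m) (𝓡 1) ∞
      (fun x : StdSpace n l m => χ (fun i => (x.1 i).phase, x.2.1)) x := by
  have hprod : (fun x : StdSpace n l m => χ (fun i => (x.1 i).phase, x.2.1)) = fun x =>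
      (∏ i, χ (Pi.mulSingle i (x.1 i).phase, 1)) * ∏ i, χ (1, Pi.mulSingle i (x.2.1 i)) :=
    funext fun x => torus_hom_eq_prod χ _ _
  rw [hprod]
  have hfst : ∀ i, ContMDiffAt (stdModel n l m) 𝓘(ℝ, ℂ) ∞
      (fun x : StdSpace n l m => x.1 i) x := fun i =>
    contMDiffAt_pi_space.1 contMDiffAt_fst i
  have hsnd : ∀ i, ContMDiffAt (stdModel n l m) (𝓡 1) ∞
      (fun x : StdSpace n l m => x.2.1 i) x := fun i =>
    contMDiffAt_torus_iff.1 (contMDiffAt_fst.comp x contMDiffAt_snd) i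
  refine ContMDiffAt.mul (contMDiffAt_finsetProd fun i _ => ?_)
    (contMDiffAt_finsetProd fun i _ => ?_)
  · by_cases hi : x.1 i = 0
    · simp only [h i hi]
      exact contMDiffAt_const
    · obtain ⟨a, ha⟩ := Circle.exists_eq_zpow
        (χ := χ.comp ((MonoidHom.inl _ _).comp (MonoidHom.mulSingle (fun _ => Circle) i)))
        (hχ.comp (f := fun z : Circle => ((Pi.mulSingle i z, 1) : Torus n × Torus l))
          ((continuous_mulSingle_circle i).prodMk continuous_const))
      have ha' : ∀ z, χ (Pi.mulSingle i z, 1) = z ^ a := ha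
      simp only [ha']
      exact ((hfst i).phase hi).circle_zpow a
  · obtain ⟨a, ha⟩ := Circle.exists_eq_zpow
      (χ := χ.comp ((MonoidHom.inr _ _).comp (MonoidHom.mulSingle (fun _ => Circle) i)))
      (hχ.comp (f := fun z : Circle => ((1, Pi.mulSingle i z) : Torus n × Torus l))
        (continuous_const.prodMk (continuous_mulSingle_circle i)))
    have ha' : ∀ z, χ (1, Pi.mulSingle i z) = z ^ a := ha
    simp only [ha']
    exact (hsnd i).circle_zpow a

end Characters

/-! ### The unique involution of the circle -/

section Involution

theorem Circle.exists_ne_one_mul_self : ∃ ζ : Circle, ζ ≠ 1 ∧ ζ * ζ = 1 := by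
  refine ⟨Circle.exp Real.pi, fun h => ?_, ?_⟩
  · have := congrArg (fun z : Circle => (z : ℂ)) h
    simp only [Circle.coe_exp, Complex.exp_pi_mul_I, Circle.coe_one] at this
    norm_num at this
  · rw [← Circle.exp_add, ← two_mul, Circle.exp_two_pi]

theorem Circle.eq_of_ne_one_of_mul_self {ζ ξ : Circle} (hζ : ζ ≠ 1) (hζ2 : ζ * ζ = 1)
    (hξ : ξ ≠ 1) (hξ2 : ξ * ξ = 1) : ζ = ξ := by
  have key : ∀ ζ : Circle, ζ ≠ 1 → ζ * ζ = 1 → (ζ : ℂ) = -1 := fun ζ h h2 => by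
    have h3 : (ζ : ℂ) * ζ = 1 := by exact_mod_cast congrArg (fun z : Circle => (z : ℂ)) h2
    exact (mul_self_eq_one_iff.1 h3).resolve_left fun h4 => h (Circle.ext h4)
  exact Circle.ext ((key ζ hζ hζ2).trans (key ξ hξ hξ2).symm)

end Involution

/-! ### Isotropy groups and germs of diffeomorphisms of corners -/

section CornerIso

/-- The element of the `i`-th coordinate circle of `T^n × T^l` with coordinate `z`. -/
noncomputable def coordCircle {n l : ℕ} (i : Fin n) (z : Circle) : Torus n × Torus l :=
  (Pi.mulSingle i z, 1)

/-- `t` fixes the orbit of the standard action lying over the point `w` of the corner. -/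
def FixesOver {n l m : ℕ} (t : Torus n × Torus l) (w : CornerSpace n m) : Prop :=
  (∀ i, w.1 i ≠ 0 → t.1 i = 1) ∧ t.2 = 1

variable {n l m : ℕ}

theorem fixesOver_coordCircle {i : Fin n} {z : Circle} {w : CornerSpace n m} :
    FixesOver (coordCircle i z : Torus n × Torus l) w ↔ (w.1 i ≠ 0 → z = 1) := by
  refine ⟨fun h hi => by simpa [coordCircle] using h.1 i hi, fun h => ⟨fun j hj => ?_, rfl⟩⟩
  by_cases hij : j = i
  · subst hij; simpa [coordCircle] using h hj
  · simp [coordCircle, hij]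

theorem forall_fixesOver_coordCircle {i : Fin n} {w : CornerSpace n m} :
    (∀ z, FixesOver (coordCircle i z : Torus n × Torus l) w) ↔ w.1 i = 0 := by
  simp only [fixesOver_coordCircle]
  refine ⟨fun h => ?_, fun h z hz => absurd h hz⟩
  by_contra hi
  obtain ⟨ζ, hζ, -⟩ := Circle.exists_ne_one_mul_self
  exact hζ (h ζ hi)

theorem fixesOver_wall {i : Fin n} {w : CornerSpace n m} (hw : ∀ j, w.1 j = 0 ↔ j = i)
    {t : Torus n × Torus l} : FixesOver t w ↔ ∃ z, t = coordCircle i z := by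
  refine ⟨fun h => ⟨t.1 i, Prod.ext (funext fun j => ?_) h.2⟩, ?_⟩
  · by_cases hij : j = i
    · subst hij; simp [coordCircle]
    · rw [h.1 j fun h0 => hij ((hw j).1 h0)]; simp [coordCircle, hij]
  · rintro ⟨z, rfl⟩
    exact forall_fixesOver_coordCircle.2 ((hw i).2 rfl) z

theorem coordCircle_mul (i : Fin n) (z z' : Circle) :
    (coordCircle i z * coordCircle i z' : Torus n × Torus l) = coordCircle i (z * z') := by
  simp [coordCircle, Pi.mulSingle_mul]

theorem coordCircle_one (i : Fin n) : (coordCircle i 1 : Torus n × Torus l) = 1 := by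
  simp [coordCircle]

theorem coordCircle_fst_self (i : Fin n) (z : Circle) :
    (coordCircle i z : Torus n × Torus l).1 i = z := by simp [coordCircle]

theorem coordCircle_injective (i : Fin n) :
    Function.Injective (coordCircle i : Circle → Torus n × Torus l) := fun z z' h => by
  rw [← coordCircle_fst_self (l := l) i z, h, coordCircle_fst_self]

/-- Adding a small `ε > 0` to all coordinates outside `S` reaches a generic point of the face cut
out by `S`. Singletons give generic wall points, the empty set interior points. -/
theorem exists_perturbation {w₀ : CornerSpace n m} (hw₀ : w₀ ∈ corner n m) {S : Set (Fin n)}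
    (hS : ∀ i ∈ S, w₀.1 i = 0) {p : CornerSpace n m → Prop}
    (hp : ∀ᶠ w in 𝓝[corner n m] w₀, p w) : ∃ w ∈ corner n m, p w ∧ ∀ j, w.1 j = 0 ↔ j ∈ S := by
  classical
  let q : ℝ → CornerSpace n m := fun ε => (fun j => if j ∈ S then 0 else w₀.1 j + ε, w₀.2)
  have hq0 : q 0 = w₀ := by
    refine Prod.ext (funext fun j => ?_) rfl
    by_cases hj : j ∈ S
    · simp [q, hj, hS j hj]
    · simp [q, hj]
  have hqc : Continuous q := by
    refine Continuous.prodMk (continuous_pi fun j => ?_) continuous_const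
    by_cases hj : j ∈ S
    · simp only [hj, if_true]; exact continuous_const
    · simp only [hj, if_false]; fun_prop
  have hqpos : ∀ ε > 0, q ε ∈ corner n m := fun ε hε j => by
    by_cases hj : j ∈ S
    · simp [q, hj]
    · simp only [q, hj, if_false]; linarith [hw₀ j]
  have ht : Tendsto q (𝓝[>] 0) (𝓝[corner n m] w₀) := by
    refine tendsto_nhdsWithin_of_tendsto_nhds_of_eventually_within _ ?_ ?_
    · have := hqc.tendsto 0
      rw [hq0] at this
      exact this.mono_left nhdsWithin_le_nhds
    · filter_upwards [self_mem_nhdsWithin] with ε hε using hqpos ε hε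
  obtain ⟨ε, hε, hε0⟩ := ((ht.eventually hp).and self_mem_nhdsWithin).exists
  refine ⟨q ε, hqpos ε hε0, hε, fun j => ?_⟩
  by_cases hj : j ∈ S
  · simp [q, hj]
  · have : w₀.1 j + ε ≠ 0 := by
      have : (0 : ℝ) < ε := hε0
      linarith [hw₀ j]
    simp [q, hj, this]

variable {n' l' m' : ℕ}

/-- `φ` and `ψ` are inverse germs of diffeomorphisms between corners which are compatible with the
isotropy groups of the standard actions under the identification `A` of tori. -/
structure CornerIso (A : Torus n × Torus l ≃ₜ* Torus n' × Torus l')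
    (φ : CornerSpace n m → CornerSpace n' m') (ψ : CornerSpace n' m' → CornerSpace n m)
    (w₀ : CornerSpace n m) : Prop where
  mem : w₀ ∈ corner n m
  mapsTo : ∀ w ∈ corner n m, φ w ∈ corner n' m'
  mapsTo_inv : ∀ v ∈ corner n' m', ψ v ∈ corner n m
  smooth : CornerSpace.SmoothNear φ w₀
  smooth_inv : CornerSpace.SmoothNear ψ (φ w₀)
  left_inv : ∀ᶠ w in 𝓝[corner n m] w₀, ψ (φ w) = w
  right_inv : ∀ᶠ v in 𝓝[corner n' m'] (φ w₀), φ (ψ v) = v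
  fixes : ∀ᶠ w in 𝓝[corner n m] w₀, ∀ t, FixesOver t w ↔ FixesOver (A t) (φ w)

namespace CornerIso

variable {A : Torus n × Torus l ≃ₜ* Torus n' × Torus l'}
  {φ : CornerSpace n m → CornerSpace n' m'} {ψ : CornerSpace n' m' → CornerSpace n m}
  {w₀ : CornerSpace n m}

theorem tendsto (h : CornerIso A φ ψ w₀) :
    Tendsto φ (𝓝[corner n m] w₀) (𝓝[corner n' m'] (φ w₀)) := h.smooth.tendsto h.mem h.mapsTo

theorem tendsto_inv (h : CornerIso A φ ψ w₀) :
    Tendsto ψ (𝓝[corner n' m'] (φ w₀)) (𝓝[corner n m] w₀) := by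
  have := h.smooth_inv.tendsto (h.mapsTo _ h.mem) h.mapsTo_inv
  rwa [h.left_inv.self_of_nhdsWithin h.mem] at this

/-- At a generic point `v` of the wall `j` near `φ w₀` the isotropy group is exactly the `j`-th
circle, so that of `ψ v` is its preimage under `A`. It is nontrivial, so a coordinate of `ψ v`
vanishes. Only one does: two would embed two coordinate circles into a single circle, which has just
one element of order two. -/
theorem exists_wall (h : CornerIso A φ ψ w₀) {j : Fin n'} (hj : (φ w₀).1 j = 0) :
    ∃ i, w₀.1 i = 0 ∧ ∀ t, (∃ ζ, A t = coordCircle j ζ) ↔ ∃ z, t = coordCircle i z := by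
  obtain ⟨v, hv, ⟨hφψ, hfix⟩, hvj⟩ := exists_perturbation (S := {j}) (h.mapsTo _ h.mem)
    (by rintro _ rfl; exact hj) (h.right_inv.and (h.tendsto_inv.eventually h.fixes))
  rw [hφψ] at hfix
  have hfix' : ∀ t, FixesOver t (ψ v) ↔ ∃ ζ, A t = coordCircle j ζ := fun t =>
    (hfix t).trans (fixesOver_wall hvj)
  obtain ⟨ζ, hζ, hζ2⟩ := Circle.exists_ne_one_mul_self
  have h0 := (hfix' (A.symm (coordCircle j ζ))).2 ⟨ζ, A.apply_symm_apply _⟩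
  obtain ⟨i, hi⟩ : ∃ i, (ψ v).1 i = 0 := by
    by_contra! hne
    have h1 : A.symm (coordCircle j ζ) = 1 :=
      Prod.ext (funext fun i => h0.1 i (hne i)) h0.2
    have h2 : (coordCircle j ζ : Torus n' × Torus l') = coordCircle j 1 := by
      rw [coordCircle_one, ← A.apply_symm_apply (coordCircle j ζ), h1, map_one]
    exact hζ (coordCircle_injective j h2)
  have huniq : ∀ i', (ψ v).1 i' = 0 ↔ i' = i := by
    refine fun i' => ⟨fun hi' => ?_, fun h => h ▸ hi⟩
    by_contra hne
    have key : ∀ i, (ψ v).1 i = 0 → ∃ ξ : Circle, A (coordCircle i ζ) = coordCircle j ξ ∧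
        ξ ≠ 1 ∧ ξ * ξ = 1 := by
      intro i hi
      obtain ⟨ξ, hξ⟩ := (hfix' _).1 (forall_fixesOver_coordCircle.2 hi ζ)
      refine ⟨ξ, hξ, fun h1 => ?_, coordCircle_injective j (l := l') ?_⟩
      · rw [h1, coordCircle_one, ← map_one A] at hξ
        have h2 := A.injective hξ
        rw [← coordCircle_one i] at h2
        exact hζ (coordCircle_injective i h2)
      · rw [← coordCircle_mul, ← hξ, ← map_mul, coordCircle_mul, hζ2, coordCircle_one, map_one,
          coordCircle_one]
    obtain ⟨ξ, hξ, hξ1, hξ2⟩ := key i hi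
    obtain ⟨ξ', hξ', hξ1', hξ2'⟩ := key i' hi'
    rw [Circle.eq_of_ne_one_of_mul_self hξ1' hξ2' hξ1 hξ2, ← hξ] at hξ'
    have h2 := congrArg (fun t : Torus n × Torus l => t.1 i') (A.injective hξ')
    simp [coordCircle, hne] at h2
    exact hζ h2
  refine ⟨i, ?_, fun t => (hfix' t).symm.trans (fixesOver_wall huniq)⟩
  -- Back at `w₀` itself: the `j`-th circle fixes the orbit over `φ w₀`, so the `i`-th circle fixes
  -- the one over `w₀`.
  rw [← forall_fixesOver_coordCircle (l := l)]
  intro z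
  obtain ⟨ξ, hξ⟩ := (hfix' _).1 (forall_fixesOver_coordCircle.2 hi z)
  rw [h.fixes.self_of_nhdsWithin h.mem, hξ]
  exact forall_fixesOver_coordCircle.2 hj ξ

theorem eventually_wall_iff (h : CornerIso A φ ψ w₀) {j : Fin n'} {i : Fin n}
    (hA : ∀ t, (∃ ζ, A t = coordCircle j ζ) ↔ ∃ z, t = coordCircle i z) :
    ∀ᶠ w in 𝓝[corner n m] w₀, (φ w).1 j = 0 ↔ w.1 i = 0 := by
  filter_upwards [h.fixes] with w hw
  rw [← forall_fixesOver_coordCircle (l := l'), ← forall_fixesOver_coordCircle (l := l)]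
  constructor
  · intro h1 z
    obtain ⟨ζ, hζ⟩ := (hA _).2 ⟨z, rfl⟩
    rw [hw, hζ]; exact h1 ζ
  · intro h1 ζ
    obtain ⟨z, hz⟩ := (hA (A.symm (coordCircle j ζ))).1 ⟨ζ, A.apply_symm_apply _⟩
    rw [← A.apply_symm_apply (coordCircle j ζ), ← hw, hz]; exact h1 z

theorem _root_.CornerSpace.SmoothNear.fst_apply {φ : CornerSpace n m → CornerSpace n' m'}
    {w₀ : CornerSpace n m} (h : CornerSpace.SmoothNear φ w₀) (j : Fin n') :
    CornerSpace.SmoothNear (fun w => (φ w).1 j) w₀ := by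
  obtain ⟨W, hW, hw, hφ⟩ := h
  exact ⟨W, hW, hw, contDiffOn_pi.1 hφ.fst j⟩

theorem _root_.CornerSpace.SmoothNear.snd {φ : CornerSpace n m → CornerSpace n' m'}
    {w₀ : CornerSpace n m} (h : CornerSpace.SmoothNear φ w₀) :
    CornerSpace.SmoothNear (fun w => (φ w).2) w₀ := by
  obtain ⟨W, hW, hw, hφ⟩ := h
  exact ⟨W, hW, hw, hφ.snd⟩

/-- Since the walls `i` and `j` correspond, `φ_j = w_i r` and, for the inverse, `ψ_i = v_j g`.
Substituting gives `r * (g ∘ φ) = 1` wherever `w_i ≠ 0`. Interior points accumulate at `w₀`, so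
continuity excludes `r w₀ = 0`. -/
theorem exists_factor (h : CornerIso A φ ψ w₀) {j : Fin n'} {i : Fin n}
    (hA : ∀ t, (∃ ζ, A t = coordCircle j ζ) ↔ ∃ z, t = coordCircle i z) :
    ∃ r : CornerSpace n m → ℝ, CornerSpace.SmoothNear r w₀ ∧ r w₀ ≠ 0 ∧
      ∀ᶠ w in 𝓝[corner n m] w₀, (φ w).1 j = w.1 i * r w := by
  have hwall := h.eventually_wall_iff hA
  obtain ⟨r, hr, hre⟩ := (h.smooth.fst_apply j).exists_quotient i
    (hwall.mono fun w hw => hw.2)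
  obtain ⟨g, hg, hge⟩ := (h.smooth_inv.fst_apply i).exists_quotient j (by
    filter_upwards [h.right_inv, h.tendsto_inv.eventually hwall] with v hv hv' h0
    rw [hv] at hv'; exact hv'.1 h0)
  refine ⟨r, hr, fun hr0 => ?_, hre⟩
  have hcont : Tendsto (fun w => r w * g (φ w)) (𝓝[corner n m] w₀) (𝓝 (r w₀ * g (φ w₀))) :=
    Tendsto.mul (hr.continuousWithinAt h.mem)
      ((hg.continuousWithinAt (h.mapsTo _ h.mem)).tendsto.comp h.tendsto)
  rw [hr0, zero_mul] at hcont
  obtain ⟨w, -, ⟨⟨⟨h1, h2⟩, h3⟩, h4⟩, h5⟩ := exists_perturbation (S := ∅) h.mem (by simp)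
    (((hcont.eventually_ne zero_ne_one).and hre).and (h.tendsto.eventually hge) |>.and h.left_inv)
  have hwi : w.1 i ≠ 0 := fun h0 => (h5 i).1 h0
  rw [h4, h2] at h3
  refine h1 (mul_left_cancel₀ hwi ?_)
  rw [mul_one]
  linarith

/-- At a generic point of the wall `i'` the `i'`-th circle is isotropy, while `φ_j` is nonzero
there, as its zeros lie on the wall `i`. -/
theorem coordCircle_apply_eq_one (h : CornerIso A φ ψ w₀) {j : Fin n'} {i : Fin n}
    (hA : ∀ t, (∃ ζ, A t = coordCircle j ζ) ↔ ∃ z, t = coordCircle i z) {i' : Fin n}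
    (hi' : w₀.1 i' = 0) (hne : i' ≠ i) (z : Circle) : (A (coordCircle i' z)).1 j = 1 := by
  obtain ⟨w, -, ⟨h1, h2⟩, h3⟩ := exists_perturbation (S := {i'}) h.mem
    (by rintro _ rfl; exact hi') (h.fixes.and (h.eventually_wall_iff hA))
  refine ((h1 _).1 (forall_fixesOver_coordCircle.2 ((h3 i').2 rfl) z)).1 j fun h0 => hne ?_
  exact ((h3 i).1 (h2.1 h0)).symm

end CornerIso

end CornerIso

/-! ### Smoothness of equivariant maps between standard models -/

section StandardModel

variable {n l m n' l' m' : ℕ}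

theorem ContMDiffAt.mul_complex {E H X : Type*} [NormedAddCommGroup E] [NormedSpace ℝ E]
    [TopologicalSpace H] {I : ModelWithCorners ℝ E H} [TopologicalSpace X] [ChartedSpace H X]
    {f g : X → ℂ} {x : X} (hf : ContMDiffAt I 𝓘(ℝ, ℂ) ∞ f x)
    (hg : ContMDiffAt I 𝓘(ℝ, ℂ) ∞ g x) : ContMDiffAt I 𝓘(ℝ, ℂ) ∞ (fun y => f y * g y) x :=
  ContMDiffAt.comp (g := fun p : ℂ × ℂ => p.1 * p.2) (I' := 𝓘(ℝ, ℂ × ℂ)) x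
    (ContDiff.contMDiff (by fun_prop)).contMDiffAt (hf.prodMk_space hg)

theorem stdOrbitMap_mem_corner (x : StdSpace n l m) : stdOrbitMap x ∈ corner n m :=
  fun _ => sq_nonneg _

theorem contMDiff_stdOrbitMap : ContMDiff (stdModel n l m) 𝓘(ℝ, CornerSpace n m) ∞
    (stdOrbitMap : StdSpace n l m → CornerSpace n m) := by
  have h1 : ContDiff ℝ ∞ fun z : Fin n → ℂ => fun i => ‖z i‖ ^ 2 :=
    contDiff_pi.2 fun i => (contDiff_apply ℝ ℂ i).norm_sq ℝ
  exact (h1.contMDiff.comp contMDiff_fst).prodMk_space (contMDiff_snd.comp contMDiff_snd)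

theorem continuous_stdOrbitMap :
    Continuous (stdOrbitMap : StdSpace n l m → CornerSpace n m) :=
  contMDiff_stdOrbitMap.continuous

theorem continuous_stdSection :
    Continuous (stdSection : CornerSpace n m → StdSpace n l m) := by
  unfold stdSection; fun_prop

theorem stdOrbitMap_stdSection {w : CornerSpace n m} (hw : w ∈ corner n m) :
    stdOrbitMap (stdSection w : StdSpace n l m) = w := by
  refine Prod.ext (funext fun i => ?_) rfl
  simp [stdOrbitMap, stdSection, Real.sq_sqrt (hw i)]

theorem stdAct_phase (x : StdSpace n l m) :
    stdAct (fun i => (x.1 i).phase, x.2.1) (stdSection (stdOrbitMap x)) = x := by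
  refine Prod.ext (funext fun i => ?_) (Prod.ext (mul_one _) rfl)
  simp only [stdAct, stdSection, stdOrbitMap, Real.sqrt_sq (norm_nonneg _)]
  rw [mul_comm, Complex.norm_mul_phase]

theorem stdAct_stdSection_eq_iff (t : Torus n × Torus l) {w : CornerSpace n m}
    (hw : w ∈ corner n m) :
    stdAct t (stdSection w : StdSpace n l m) = stdSection w ↔ FixesOver t w := by
  have h0 : ∀ i, ((√(w.1 i) : ℝ) : ℂ) = 0 ↔ w.1 i = 0 := fun i => by
    rw [Complex.ofReal_eq_zero, Real.sqrt_eq_zero (hw i)]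
  simp only [stdAct, stdSection, FixesOver, Prod.ext_iff, mul_one, and_true, funext_iff,
    Pi.one_apply]
  refine and_congr_left fun _ => forall_congr' fun i => ?_
  rw [Ne, ← h0 i]
  refine ⟨fun h hi => Circle.ext ?_, fun h => ?_⟩
  · rwa [mul_eq_right₀ hi] at h
  · by_cases hi : ((√(w.1 i) : ℝ) : ℂ) = 0
    · rw [hi, mul_zero]
    · rw [h hi, Circle.coe_one, one_mul]

/-- This is where the singularities of phases and square roots cancel, by matching isotropy with
vanishing coordinates. -/
theorem CornerIso.contMDiffAt {A : Torus n × Torus l ≃ₜ* Torus n' × Torus l'}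
    {φ : CornerSpace n m → CornerSpace n' m'} {ψ : CornerSpace n' m' → CornerSpace n m}
    {x₀ : StdSpace n l m} (h : CornerIso A φ ψ (stdOrbitMap x₀)) :
    ContMDiffAt (stdModel n l m) (stdModel n' l' m') ∞ (fun x : StdSpace n l m =>
      (stdAct (A (fun i => (x.1 i).phase, x.2.1)) (stdSection (φ (stdOrbitMap x))) :
        StdSpace n' l' m')) x₀ := by
  have hzero : ∀ i, (stdOrbitMap x₀).1 i = 0 ↔ x₀.1 i = 0 := fun i => by
    simp [stdOrbitMap]
  have hfix := h.fixes.self_of_nhdsWithin h.mem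
  have horb := contMDiff_stdOrbitMap.contMDiffAt (x := x₀)
  have hev : Tendsto (stdOrbitMap : StdSpace n l m → _) (𝓝 x₀)
      (𝓝[corner n m] (stdOrbitMap x₀)) :=
    tendsto_nhdsWithin_of_tendsto_nhds_of_eventually_within _
      continuous_stdOrbitMap.continuousAt (Eventually.of_forall stdOrbitMap_mem_corner)
  have hpi : ∀ i, ContMDiffAt (stdModel n l m) 𝓘(ℝ, ℂ) ∞ (fun x : StdSpace n l m => x.1 i) x₀ :=
    fun i => contMDiffAt_pi_space.1 contMDiffAt_fst i
  let χ : Fin n' → Torus n × Torus l →* Circle := fun j =>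
    ((Pi.evalMonoidHom _ j).comp (MonoidHom.fst _ _)).comp (A : _ →* Torus n' × Torus l')
  have hχ : ∀ j, Continuous (χ j) := fun j =>
    (continuous_apply j).comp (continuous_fst.comp A.continuous)
  refine (contMDiffAt_pi_space.2 fun j => ?_).prodMk
    (ContMDiffAt.prodMk (contMDiffAt_torus_iff.2 fun j => ?_) ?_)
  · change ContMDiffAt (stdModel n l m) 𝓘(ℝ, ℂ) ∞ (fun x : StdSpace n l m =>
      (χ j (fun i => (x.1 i).phase, x.2.1) : ℂ) * ((√((φ (stdOrbitMap x)).1 j) : ℝ) : ℂ)) x₀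
    by_cases hj : (φ (stdOrbitMap x₀)).1 j = 0
    · obtain ⟨i, hi, hA⟩ := h.exists_wall hj
      obtain ⟨r, hr, hr0, hre⟩ := h.exists_factor hA
      let ε : Circle →* Circle := (χ j).comp
        ((MonoidHom.inl _ _).comp (MonoidHom.mulSingle (fun _ => Circle) i))
      have hε : ∀ z, ε z = χ j (coordCircle i z) := fun z => rfl
      have hεc : Continuous ε := (hχ j).comp
        (f := fun z : Circle => (coordCircle i z : Torus n × Torus l))
          ((continuous_mulSingle_circle i).prodMk continuous_const)
      have hεi : Function.Injective ε := by
        rw [injective_iff_map_eq_one]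
        intro z hz
        obtain ⟨ζ, hζ⟩ := (hA _).2 ⟨z, rfl⟩
        have h1 : ε z = ζ := by
          change (A (coordCircle i z)).1 j = ζ
          rw [hζ, coordCircle_fst_self]
        rw [← h1, hz, coordCircle_one, ← map_one A, ← coordCircle_one i] at hζ
        exact coordCircle_injective i (A.injective hζ)
      -- Splitting off the restriction of `χ j` to the `i`-th circle leaves a character that is
      -- trivial on that circle and on the other circles whose coordinates vanish at `x₀`.
      let χ' : Torus n × Torus l →* Circle :=
        χ j * (ε.comp ((Pi.evalMonoidHom _ i).comp (MonoidHom.fst _ _)))⁻¹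
      have hχ'a : ∀ t, χ' t = χ j t * (ε (t.1 i))⁻¹ := fun t => rfl
      have hχ' : Continuous χ' :=
        (hχ j).mul (hεc.comp ((continuous_apply i).comp continuous_fst)).inv
      have hsm := contMDiffAt_hom_phase hχ' (x := x₀) (by
        intro i' hi' z
        change χ' (coordCircle i' z) = 1
        rw [hχ'a]
        by_cases hne : i' = i
        · subst hne
          rw [coordCircle_fst_self, hε, mul_inv_cancel]
        · have h1 : χ j (coordCircle i' z) = 1 :=
            h.coordCircle_apply_eq_one hA ((hzero i').2 hi') hne z
          rw [h1]
          simp [coordCircle, Ne.symm hne])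
      have hcoord : ContMDiffAt (stdModel n l m) 𝓘(ℝ, ℂ) ∞
          (fun x : StdSpace n l m => (‖x.1 i‖ : ℂ) * (ε (x.1 i).phase : ℂ)) x₀ := by
        -- The product of modulus and phase is `z_i` or its complex conjugate, smooth also at `0`.
        rcases Circle.eq_id_or_inv hεc hεi with h1 | h1
        · simp only [h1, Complex.norm_mul_phase]
          exact hpi i
        · have h2 : ∀ z : ℂ, (‖z‖ : ℂ) * ((z.phase⁻¹ : Circle) : ℂ) = Complex.conjCLE z :=
            fun z => by
              rw [Circle.coe_inv_eq_conj]
              nth_rewrite 3 [← Complex.norm_mul_phase z]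
              simp
          simp only [h1, h2]
          exact Complex.conjCLE.contDiff.contMDiff.contMDiffAt.comp x₀ (hpi i)
      have hroot : ContMDiffAt (stdModel n l m) 𝓘(ℝ, ℂ) ∞
          (fun x : StdSpace n l m => ((√(r (stdOrbitMap x)) : ℝ) : ℂ)) x₀ :=
        ((Complex.ofRealCLM.contDiff.contDiffAt.comp _
          (Real.contDiffAt_sqrt hr0)).contMDiffAt).comp x₀
            (hr.contMDiffAt_comp horb stdOrbitMap_mem_corner)
      have hprod := ((contMDiff_circle_coe.contMDiffAt.comp x₀ hsm).mul_complex hcoord).mul_complex hroot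
      refine hprod.congr_of_eventuallyEq ?_
      filter_upwards [hev.eventually hre] with x hx
      rw [hx]
      have h1 : χ j (fun i => (x.1 i).phase, x.2.1) =
          χ' (fun i => (x.1 i).phase, x.2.1) * ε (x.1 i).phase := by
        rw [hχ'a, inv_mul_cancel_right]
      -- Only `|z_i|² ≥ 0` is needed to split the root; the sign of `r` plays no role.
      rw [h1, Real.sqrt_mul (stdOrbitMap_mem_corner x i)]
      simp only [stdOrbitMap, Real.sqrt_sq (norm_nonneg _), Circle.coe_mul, Complex.ofReal_mul,
        Function.comp]
      ring
    · have hsm := contMDiffAt_hom_phase (hχ j) (x := x₀) fun i hi z =>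
        ((hfix _).1 (forall_fixesOver_coordCircle.2 ((hzero i).2 hi) z)).1 j hj
      have hroot : ContMDiffAt (stdModel n l m) 𝓘(ℝ, ℂ) ∞
          (fun x : StdSpace n l m => ((√((φ (stdOrbitMap x)).1 j) : ℝ) : ℂ)) x₀ :=
        ((Complex.ofRealCLM.contDiff.contDiffAt.comp _
          (Real.contDiffAt_sqrt hj)).contMDiffAt).comp x₀
            ((h.smooth.fst_apply j).contMDiffAt_comp horb stdOrbitMap_mem_corner)
      exact (contMDiff_circle_coe.contMDiffAt.comp x₀ hsm).mul_complex hroot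
  · let χ₂ : Torus n × Torus l →* Circle :=
      ((Pi.evalMonoidHom _ j).comp (MonoidHom.snd _ _)).comp (A : _ →* Torus n' × Torus l')
    have hχ₂ : Continuous χ₂ := (continuous_apply j).comp (continuous_snd.comp A.continuous)
    have hsm := contMDiffAt_hom_phase hχ₂ (x := x₀) fun i hi z =>
      congrFun ((hfix _).1 (forall_fixesOver_coordCircle.2 ((hzero i).2 hi) z)).2 j
    refine hsm.congr_of_eventuallyEq (Eventually.of_forall fun x => ?_)
    exact mul_one _
  · exact h.smooth.snd.contMDiffAt_comp horb stdOrbitMap_mem_corner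

end StandardModel

/-! ### The orbit space and its induced charts -/

section OrbitSpace

variable {k d : ℕ} {M : Type*} [MulAction (Torus k) M]

theorem orbitMk_eq_iff {x y : M} : orbitMk k x = orbitMk k y ↔ ∃ t : Torus k, t • y = x :=
  Quotient.eq.trans MulAction.orbitRel_apply

theorem orbitMk_smul (t : Torus k) (x : M) : orbitMk k (t • x) = orbitMk k x :=
  orbitMk_eq_iff.2 ⟨t, rfl⟩

theorem orbitMk_surjective : Function.Surjective (orbitMk k : M → OrbitSpace k M) :=
  Quotient.mk_surjective

theorem mem_characteristicFunction {t : Torus k} {x : M} :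
    t ∈ characteristicFunction k (orbitMk k x) ↔ t • x = x := Iff.rfl

variable [TopologicalSpace M]

theorem continuous_orbitMk : Continuous (orbitMk k : M → OrbitSpace k M) := continuous_quot_mk

variable [ChartedSpace (EuclideanSpace ℝ (Fin d)) M]

theorem continuousConstSMul_of_contMDiffSMul
    [ContMDiffSMul (torusModel k) (𝓡 d) ∞ (Torus k) M] : ContinuousConstSMul (Torus k) M where
  continuous_const_smul t :=
    (contMDiff_smul (I := torusModel k) (I' := 𝓡 d) (n := ∞) (G := Torus k)
      (M := M)).continuous.comp (Continuous.prodMk_right t)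

theorem isOpenMap_orbitMk [ContMDiffSMul (torusModel k) (𝓡 d) ∞ (Torus k) M] :
    IsOpenMap (orbitMk k : M → OrbitSpace k M) :=
  haveI : ContinuousConstSMul (Torus k) M := continuousConstSMul_of_contMDiffSMul (d := d)
  isOpenMap_quotient_mk'_mul

namespace StandardChart

variable (c : StandardChart k d M)

theorem symm_mem (v : StdSpace c.n c.l c.m) : c.e.symm v ∈ c.e.source :=
  c.e.map_target (by rw [c.target_eq]; trivial)

theorem apply_symm (v : StdSpace c.n c.l c.m) : c.e (c.e.symm v) = v :=
  c.e.right_inv (by rw [c.target_eq]; trivial)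

theorem symm_stdAct (t : Torus k) (v : StdSpace c.n c.l c.m) :
    c.e.symm (stdAct (c.split t) v) = t • c.e.symm v := by
  rw [← c.e.left_inv (c.smul_mem t _ (c.symm_mem v)), c.equivariant t _ (c.symm_mem v),
    c.apply_symm]

theorem mem_orbitDomain_iff {x : M} : orbitMk k x ∈ c.orbitDomain ↔ x ∈ c.e.source := by
  refine ⟨?_, fun h => ⟨x, h, rfl⟩⟩
  rintro ⟨y, hy, hxy⟩
  obtain ⟨t, rfl⟩ := orbitMk_eq_iff.1 hxy.symm
  exact c.smul_mem t y hy

theorem orbitChart_mk {x : M} (hx : x ∈ c.e.source) :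
    c.orbitChart (orbitMk k x) = stdOrbitMap (c.e x) := if_pos hx

theorem orbitChart_mem_corner (p : OrbitSpace k M) : c.orbitChart p ∈ corner c.n c.m := by
  obtain ⟨x, rfl⟩ := orbitMk_surjective p
  by_cases hx : x ∈ c.e.source
  · rw [c.orbitChart_mk hx]; exact stdOrbitMap_mem_corner _
  · have : c.orbitChart (orbitMk k x) = 0 := if_neg hx
    rw [this]; exact fun i => le_rfl

theorem orbitChart_orbitChartInv {w : CornerSpace c.n c.m} (hw : w ∈ corner c.n c.m) :
    c.orbitChart (c.orbitChartInv w) = w := by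
  rw [orbitChartInv, localSection, c.orbitChart_mk (c.symm_mem _), c.apply_symm,
    stdOrbitMap_stdSection hw]

theorem symm_eq_smul_localSection (v : StdSpace c.n c.l c.m) : c.e.symm v =
    c.split.symm (fun i => (v.1 i).phase, v.2.1) • c.localSection (stdOrbitMap v) := by
  rw [localSection, ← c.symm_stdAct, ContinuousMulEquiv.apply_symm_apply, stdAct_phase]

theorem orbitMk_symm (v : StdSpace c.n c.l c.m) :
    orbitMk k (c.e.symm v) = c.orbitChartInv (stdOrbitMap v) := by
  rw [c.symm_eq_smul_localSection, orbitMk_smul]; rfl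

theorem orbitChartInv_orbitChart {p : OrbitSpace k M} (hp : p ∈ c.orbitDomain) :
    c.orbitChartInv (c.orbitChart p) = p := by
  obtain ⟨x, hx, rfl⟩ := hp
  rw [c.orbitChart_mk hx, ← c.orbitMk_symm, c.e.left_inv hx]

theorem continuous_symm : Continuous c.e.symm := c.contMDiff_invFun.continuous

theorem continuous_orbitChartInv : Continuous c.orbitChartInv :=
  continuous_orbitMk.comp (c.continuous_symm.comp continuous_stdSection)

theorem smul_localSection_eq_iff (t : Torus k) {w : CornerSpace c.n c.m}
    (hw : w ∈ corner c.n c.m) :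
    t • c.localSection w = c.localSection w ↔ FixesOver (c.split t) w := by
  rw [localSection, ← c.symm_stdAct, ← stdAct_stdSection_eq_iff _ hw]
  exact ⟨fun h => by rw [← c.apply_symm (stdAct _ _), h, c.apply_symm], fun h => by rw [h]⟩

theorem contMDiffAt_apply {x : M} (hx : x ∈ c.e.source) :
    ContMDiffAt (𝓡 d) (stdModel c.n c.l c.m) ∞ c.e x :=
  c.contMDiffOn_toFun.contMDiffAt (c.e.open_source.mem_nhds hx)

section

variable [ContMDiffSMul (torusModel k) (𝓡 d) ∞ (Torus k) M]

theorem isOpen_orbitDomain : IsOpen c.orbitDomain :=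
  isOpenMap_orbitMk (d := d) _ c.e.open_source

/-- After precomposition with squaring, the transition map is computed by restricting the smooth
change of standard charts to real points of `ℂ^n`, negative ones included, so no square root
appears. Being a function of the squares it is even, and Whitney's theorem applies. -/
theorem smoothNear_transition (c' : StandardChart k d M) {p : OrbitSpace k M}
    (hp : p ∈ c.orbitDomain) (hp' : p ∈ c'.orbitDomain) :
    CornerSpace.SmoothNear (fun w => c'.orbitChart (c.orbitChartInv w)) (c.orbitChart p) := by
  let W : Set (CornerSpace c.n c.m) := c.orbitChartInv ⁻¹' c'.orbitDomain
  have hW : IsOpen W := c'.isOpen_orbitDomain.preimage c.continuous_orbitChartInv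
  let real : CornerSpace c.n c.m → StdSpace c.n c.l c.m := fun q =>
    (fun i => (q.1 i : ℂ), 1, q.2)
  have hreal : ContMDiff 𝓘(ℝ, CornerSpace c.n c.m) (stdModel c.n c.l c.m) ∞ real := by
    have h1 : ContDiff ℝ ∞ fun q : CornerSpace c.n c.m => fun i => (q.1 i : ℂ) :=
      contDiff_pi.2 fun i => Complex.ofRealCLM.contDiff.comp (by fun_prop)
    exact h1.contMDiff.prodMk (contMDiff_const.prodMk contDiff_snd.contMDiff)
  have horb : ∀ q, orbitMk k (c.e.symm (real q)) = c.orbitChartInv (CornerSpace.sq q) := fun q => by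
    rw [c.orbitMk_symm]
    congr 1
    refine Prod.ext (funext fun i => ?_) rfl
    simp [real, stdOrbitMap, CornerSpace.sq]
  have h := CornerSpace.smoothNear_comp_sqrt
    (G := fun q => c'.orbitChart (c.orbitChartInv (CornerSpace.sq q))) hW (w₀ := c.orbitChart p)
    (by simpa [W, c.orbitChartInv_orbitChart hp] using hp') (fun q hq => ?_)
    (fun i q _ => by simp only [CornerSpace.sq_reflect])
  · refine h.congr ?_
    filter_upwards [self_mem_nhdsWithin] with w hw
    rw [CornerSpace.sq_sqrt hw]
  · have hmem : ∀ q, CornerSpace.sq q ∈ W → c.e.symm (real q) ∈ c'.e.source := fun q hq => by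
      rw [← c'.mem_orbitDomain_iff, horb]; exact hq
    have hsm : ContMDiffAt 𝓘(ℝ, CornerSpace c.n c.m) 𝓘(ℝ, CornerSpace c'.n c'.m) ∞
        (fun q => stdOrbitMap (c'.e (c.e.symm (real q)))) q :=
      contMDiff_stdOrbitMap.contMDiffAt.comp q ((c'.contMDiffAt_apply (hmem q hq)).comp q
        ((c.contMDiff_invFun.comp hreal).contMDiffAt))
    refine hsm.contDiffAt.congr_of_eventuallyEq ?_
    filter_upwards [(hW.preimage CornerSpace.contDiff_sq.continuous).mem_nhds hq] with q' hq'
    rw [← horb, c'.orbitChart_mk (hmem q' hq')]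

end

end StandardChart

end OrbitSpace

/-! ### Diffeomorphisms of orbit spaces in charts -/

section OrbitMap

variable {k d₁ d₂ : ℕ} {M₁ M₂ : Type*}
    [TopologicalSpace M₁] [ChartedSpace (EuclideanSpace ℝ (Fin d₁)) M₁] [MulAction (Torus k) M₁]
    [TopologicalSpace M₂] [ChartedSpace (EuclideanSpace ℝ (Fin d₂)) M₂] [MulAction (Torus k) M₂]
    [ContMDiffSMul (torusModel k) (𝓡 d₁) ∞ (Torus k) M₁]
    [ContMDiffSMul (torusModel k) (𝓡 d₂) ∞ (Torus k) M₂]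

/-- Smooth transition maps on both sides turn smoothness in some pair of charts into smoothness in
any pair. -/
theorem OrbitSmoothAt.smoothNear {Φ : OrbitSpace k M₁ → OrbitSpace k M₂} {p : OrbitSpace k M₁}
    (h : OrbitSmoothAt k d₁ d₂ Φ p) {c₁ : StandardChart k d₁ M₁} {c₂ : StandardChart k d₂ M₂}
    (hp₁ : p ∈ c₁.orbitDomain) (hp₂ : Φ p ∈ c₂.orbitDomain) :
    CornerSpace.SmoothNear (fun w => c₂.orbitChart (Φ (c₁.orbitChartInv w)))
      (c₁.orbitChart p) := by
  obtain ⟨hcont, b₁, b₂, hb₁, hb₂, W, hW, hpW, hsm⟩ := h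
  have h1 := c₁.smoothNear_transition b₁ hp₁ hb₁
  have h2 := b₂.smoothNear_transition c₂ hb₂ hp₂
  have hinv : Tendsto c₁.orbitChartInv (𝓝 (c₁.orbitChart p)) (𝓝 p) := by
    have := c₁.continuous_orbitChartInv.tendsto (c₁.orbitChart p)
    rwa [c₁.orbitChartInv_orbitChart hp₁] at this
  have hf : CornerSpace.SmoothNear
      (fun w => b₂.orbitChart (Φ (b₁.orbitChartInv (b₁.orbitChart (c₁.orbitChartInv w)))))
      (c₁.orbitChart p) :=
    CornerSpace.SmoothNear.comp (g := fun w => b₂.orbitChart (Φ (b₁.orbitChartInv w)))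
      ⟨W, hW, by rwa [c₁.orbitChartInv_orbitChart hp₁], hsm⟩ h1 (c₁.orbitChart_mem_corner p)
      fun w _ => b₁.orbitChart_mem_corner _
  have hg := CornerSpace.SmoothNear.comp (g := fun w => c₂.orbitChart (b₂.orbitChartInv w))
    (by rw [c₁.orbitChartInv_orbitChart hp₁, b₁.orbitChartInv_orbitChart hb₁]; exact h2) hf
      (c₁.orbitChart_mem_corner p) fun w _ => b₂.orbitChart_mem_corner _
  refine hg.congr (Filter.Eventually.filter_mono nhdsWithin_le_nhds ?_)
  filter_upwards [hinv.eventually (b₁.isOpen_orbitDomain.mem_nhds hb₁),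
    (hcont.tendsto.comp hinv).eventually (b₂.isOpen_orbitDomain.mem_nhds hb₂)] with w hw1 hw2
  rw [b₁.orbitChartInv_orbitChart hw1,
    b₂.orbitChartInv_orbitChart (p := Φ (c₁.orbitChartInv w)) hw2]

theorem cornerIso_of_isOrbitDiffeomorphism {Φ : OrbitSpace k M₁ ≃ OrbitSpace k M₂}
    (hΦ : IsOrbitDiffeomorphism k d₁ d₂ Φ)
    (hchar : ∀ p, characteristicFunction k p = characteristicFunction k (Φ p))
    {p : OrbitSpace k M₁} {c₁ : StandardChart k d₁ M₁} {c₂ : StandardChart k d₂ M₂}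
    (hp₁ : p ∈ c₁.orbitDomain) (hp₂ : Φ p ∈ c₂.orbitDomain) :
    CornerIso (c₁.split.symm.trans c₂.split)
      (fun w => c₂.orbitChart (Φ (c₁.orbitChartInv w)))
      (fun v => c₁.orbitChart (Φ.symm (c₂.orbitChartInv v))) (c₁.orbitChart p) := by
  have hcont : Tendsto (fun w => Φ (c₁.orbitChartInv w)) (𝓝 (c₁.orbitChart p)) (𝓝 (Φ p)) := by
    refine (hΦ.1 p).1.tendsto.comp ?_
    have := c₁.continuous_orbitChartInv.tendsto (c₁.orbitChart p)
    rwa [c₁.orbitChartInv_orbitChart hp₁] at this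
  have hcont' : Tendsto (fun v => Φ.symm (c₂.orbitChartInv v)) (𝓝 (c₂.orbitChart (Φ p)))
      (𝓝 p) := by
    have h1 := (hΦ.2 (Φ p)).1.tendsto
    rw [Φ.symm_apply_apply] at h1
    refine h1.comp ?_
    have := c₂.continuous_orbitChartInv.tendsto (c₂.orbitChart (Φ p))
    rwa [c₂.orbitChartInv_orbitChart hp₂] at this
  have hev : ∀ᶠ w in 𝓝[corner c₁.n c₁.m] (c₁.orbitChart p),
      Φ (c₁.orbitChartInv w) ∈ c₂.orbitDomain :=
    (hcont.eventually (c₂.isOpen_orbitDomain.mem_nhds hp₂)).filter_mono nhdsWithin_le_nhds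
  have hev' : ∀ᶠ v in 𝓝[corner c₂.n c₂.m] (c₂.orbitChart (Φ p)),
      Φ.symm (c₂.orbitChartInv v) ∈ c₁.orbitDomain :=
    (hcont'.eventually (c₁.isOpen_orbitDomain.mem_nhds hp₁)).filter_mono nhdsWithin_le_nhds
  refine ⟨c₁.orbitChart_mem_corner p, fun w _ => c₂.orbitChart_mem_corner _,
    fun v _ => c₁.orbitChart_mem_corner _, (hΦ.1 p).smoothNear hp₁ hp₂, ?_, ?_, ?_, ?_⟩
  · rw [c₁.orbitChartInv_orbitChart hp₁]
    exact (hΦ.2 (Φ p)).smoothNear hp₂ (by rwa [Φ.symm_apply_apply])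
  · filter_upwards [hev, self_mem_nhdsWithin] with w hw hwc
    rw [c₂.orbitChartInv_orbitChart hw, Φ.symm_apply_apply, c₁.orbitChart_orbitChartInv hwc]
  · rw [c₁.orbitChartInv_orbitChart hp₁]
    filter_upwards [hev', self_mem_nhdsWithin] with v hv hvc
    rw [c₁.orbitChartInv_orbitChart hv, Φ.apply_symm_apply, c₂.orbitChart_orbitChartInv hvc]
  · filter_upwards [hev, self_mem_nhdsWithin] with w hw hwc t
    have h1 := c₁.smul_localSection_eq_iff (c₁.split.symm t) hwc
    have h2 := c₂.smul_localSection_eq_iff (c₁.split.symm t)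
      (c₂.orbitChart_mem_corner (Φ (c₁.orbitChartInv w)))
    rw [ContinuousMulEquiv.apply_symm_apply] at h1
    rw [ContinuousMulEquiv.trans_apply, ← h1, ← h2, ← mem_characteristicFunction,
      ← mem_characteristicFunction]
    have h3 : orbitMk k (c₂.localSection (c₂.orbitChart (Φ (c₁.orbitChartInv w)))) =
      Φ (c₁.orbitChartInv w) := c₂.orbitChartInv_orbitChart hw
    rw [h3, ← hchar]
    rfl

end OrbitMap

/-! ### The equivariant extension and its smoothness -/

section Extension

variable {k d₁ d₂ : ℕ} {M₁ M₂ : Type*}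
    [TopologicalSpace M₁] [ChartedSpace (EuclideanSpace ℝ (Fin d₁)) M₁] [MulAction (Torus k) M₁]
    [TopologicalSpace M₂] [ChartedSpace (EuclideanSpace ℝ (Fin d₂)) M₂] [MulAction (Torus k) M₂]
    {s₁ : OrbitSpace k M₁ → M₁} {s₂ : OrbitSpace k M₂ → M₂}

theorem IsRegularSection.exists_smul_eq (hs₁ : IsRegularSection k d₁ s₁) (x : M₁) :
    ∃ t : Torus k, t • s₁ (orbitMk k x) = x :=
  orbitMk_eq_iff.1 (hs₁.isSection _).symm

/-- The equivariant map `t • s₁ p ↦ t • s₂ (Φ p)`. -/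
noncomputable def equivariantExtension (hs₁ : IsRegularSection k d₁ s₁)
    (s₂ : OrbitSpace k M₂ → M₂) (Φ : OrbitSpace k M₁ → OrbitSpace k M₂) (x : M₁) : M₂ :=
  (hs₁.exists_smul_eq x).choose • s₂ (Φ (orbitMk k x))

/-- Independence of the chosen torus element: two choices differ by an element of the isotropy group
of `s₁ p`, which by `hchar` also fixes `s₂ (Φ p)`. -/
theorem equivariantExtension_smul (hs₁ : IsRegularSection k d₁ s₁)
    (hs₂ : IsRegularSection k d₂ s₂) {Φ : OrbitSpace k M₁ → OrbitSpace k M₂}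
    (hchar : ∀ p, characteristicFunction k p = characteristicFunction k (Φ p))
    (t : Torus k) (p : OrbitSpace k M₁) :
    equivariantExtension hs₁ s₂ Φ (t • s₁ p) = t • s₂ (Φ p) := by
  have hp : orbitMk k (t • s₁ p) = p := by rw [orbitMk_smul, hs₁.isSection]
  have h := (hs₁.exists_smul_eq (t • s₁ p)).choose_spec
  rw [equivariantExtension]
  set t' := (hs₁.exists_smul_eq (t • s₁ p)).choose
  rw [hp] at h ⊢
  have h1 : t⁻¹ * t' ∈ characteristicFunction k p := by
    rw [← hs₁.isSection p, mem_characteristicFunction, mul_smul, h, inv_smul_smul]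
  rw [hchar, ← hs₂.isSection (Φ p), mem_characteristicFunction, mul_smul] at h1
  rw [← inv_smul_eq_iff, h1]

theorem equivariantExtension_leftInverse (hs₁ : IsRegularSection k d₁ s₁)
    (hs₂ : IsRegularSection k d₂ s₂) {Φ : OrbitSpace k M₁ ≃ OrbitSpace k M₂}
    (hchar : ∀ p, characteristicFunction k p = characteristicFunction k (Φ p)) :
    Function.LeftInverse (equivariantExtension hs₂ s₁ Φ.symm)
      (equivariantExtension hs₁ s₂ Φ) := by
  intro x
  obtain ⟨t, ht⟩ := hs₁.exists_smul_eq x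
  rw [← ht, equivariantExtension_smul hs₁ hs₂ hchar, equivariantExtension_smul hs₂ hs₁
    (fun q => by rw [hchar, Φ.apply_symm_apply]), Φ.symm_apply_apply]

variable [ContMDiffSMul (torusModel k) (𝓡 d₁) ∞ (Torus k) M₁]
    [ContMDiffSMul (torusModel k) (𝓡 d₂) ∞ (Torus k) M₂]

theorem contMDiff_equivariantExtension (hs₁ : IsRegularSection k d₁ s₁)
    (hs₂ : IsRegularSection k d₂ s₂) {Φ : OrbitSpace k M₁ ≃ OrbitSpace k M₂}
    (hΦ : IsOrbitDiffeomorphism k d₁ d₂ Φ)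
    (hchar : ∀ p, characteristicFunction k p = characteristicFunction k (Φ p)) :
    ContMDiff (𝓡 d₁) (𝓡 d₂) ∞ (equivariantExtension hs₁ s₂ Φ) := by
  intro x
  obtain ⟨c₁, hc₁, W₁, hW₁, hpW₁, f₁, hf₁, hsf₁⟩ := hs₁.regular (orbitMk k x)
  obtain ⟨c₂, hc₂, W₂, hW₂, hpW₂, f₂, hf₂, hsf₂⟩ := hs₂.regular (Φ (orbitMk k x))
  have hx := c₁.mem_orbitDomain_iff.1 hc₁
  have h := cornerIso_of_isOrbitDiffeomorphism hΦ hchar hc₁ hc₂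
  rw [c₁.orbitChart_mk hx] at h hpW₁
  set φ : CornerSpace c₁.n c₁.m → CornerSpace c₂.n c₂.m :=
    fun w => c₂.orbitChart (Φ (c₁.orbitChartInv w)) with hφ
  have horb : ∀ y ∈ c₁.e.source, c₁.orbitChartInv (stdOrbitMap (c₁.e y)) = orbitMk k y :=
    fun y hy => by rw [← c₁.orbitMk_symm, c₁.e.left_inv hy]
  have hw : ContMDiffAt (𝓡 d₁) 𝓘(ℝ, CornerSpace c₁.n c₁.m) ∞
      (fun y => stdOrbitMap (c₁.e y)) x :=
    contMDiff_stdOrbitMap.contMDiffAt.comp x (c₁.contMDiffAt_apply hx)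
  have hφw : ContMDiffAt (𝓡 d₁) 𝓘(ℝ, CornerSpace c₂.n c₂.m) ∞
      (fun y => φ (stdOrbitMap (c₁.e y))) x :=
    CornerSpace.SmoothNear.contMDiffAt_comp (q := fun y => stdOrbitMap (c₁.e y)) h.smooth hw
      fun y => stdOrbitMap_mem_corner _
  have hφx : φ (stdOrbitMap (c₁.e x)) ∈ W₂ := by
    rw [hφ]
    simp only [horb x hx]
    exact hpW₂
  have hF₁ := CornerSpace.contMDiffAt_comp_of_contMDiffOn_corner hW₁ hf₁ hw
    (fun y => stdOrbitMap_mem_corner _) hpW₁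
  have hF₂ := CornerSpace.contMDiffAt_comp_of_contMDiffOn_corner hW₂ hf₂ hφw
    (fun y => c₂.orbitChart_mem_corner _) hφx
  -- This is the map in the case where both sections are standard in these charts; in general it is
  -- corrected by the torus factor `f₁⁻¹ f₂`, which depends smoothly on the point.
  have hZ := c₂.contMDiff_invFun.contMDiffAt.comp x
    (h.contMDiffAt.comp x (c₁.contMDiffAt_apply hx))
  have hsm := (contMDiff_smul (I := torusModel k) (I' := 𝓡 d₂) (n := ∞) (G := Torus k)
    (M := M₂)).contMDiffAt.comp x ((hF₁.torus_inv.torus_mul hF₂).prodMk hZ)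
  refine hsm.congr_of_eventuallyEq ?_
  have hΦy : ∀ᶠ y in 𝓝 x, Φ (orbitMk k y) ∈ c₂.orbitDomain :=
    ((hΦ.1 _).1.comp continuous_orbitMk.continuousAt).eventually
      (c₂.isOpen_orbitDomain.mem_nhds hc₂)
  filter_upwards [c₁.e.open_source.mem_nhds hx, hΦy,
    hw.continuousAt.eventually (hW₁.mem_nhds hpW₁),
    hφw.continuousAt.eventually (hW₂.mem_nhds hφx)] with y hy hΦy hyW₁ hyW₂
  have hφy : c₂.orbitChartInv (φ (stdOrbitMap (c₁.e y))) = Φ (orbitMk k y) := by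
    simp only [hφ, horb y hy]
    exact c₂.orbitChartInv_orbitChart hΦy
  have e₁ := hsf₁ _ ⟨stdOrbitMap_mem_corner (c₁.e y), hyW₁⟩
  have e₂ := hsf₂ _ ⟨c₂.orbitChart_mem_corner _, hyW₂⟩
  rw [horb y hy] at e₁
  rw [hφy] at e₂
  -- Writes `y` as (phase of `y`) · `f₁⁻¹` · `s₁`, so that equivariance determines its image.
  have hy' := c₁.symm_eq_smul_localSection (c₁.e y)
  rw [c₁.e.left_inv hy, ← inv_smul_eq_iff.2 e₁, smul_smul] at hy'
  conv_lhs => rw [hy', equivariantExtension_smul hs₁ hs₂ hchar, e₂]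
  simp only [Function.comp, ContinuousMulEquiv.trans_apply, c₂.symm_stdAct]
  change _ = _ • _ • c₂.localSection _
  simp only [smul_smul]
  congr 1
  simp only [mul_comm, mul_left_comm, mul_assoc]
  rfl

end Extension

/-! ### Existence and uniqueness of the equivariant diffeomorphism -/

theorem mainTheorem2 (k d₁ d₂ : ℕ)
    (M₁ : Type*) [TopologicalSpace M₁] [T2Space M₁] [SecondCountableTopology M₁]
    [ChartedSpace (EuclideanSpace ℝ (Fin d₁)) M₁] [IsManifold (𝓡 d₁) ∞ M₁]
    [MulAction (Torus k) M₁] [ContMDiffSMul (torusModel k) (𝓡 d₁) ∞ (Torus k) M₁]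
    (M₂ : Type*) [TopologicalSpace M₂] [T2Space M₂] [SecondCountableTopology M₂]
    [ChartedSpace (EuclideanSpace ℝ (Fin d₂)) M₂] [IsManifold (𝓡 d₂) ∞ M₂]
    [MulAction (Torus k) M₂] [ContMDiffSMul (torusModel k) (𝓡 d₂) ∞ (Torus k) M₂]
    (hM₁ : IsLocallyStandard k d₁ M₁) (hM₂ : IsLocallyStandard k d₂ M₂)
    (s₁ : OrbitSpace k M₁ → M₁) (hs₁ : IsRegularSection k d₁ s₁)
    (s₂ : OrbitSpace k M₂ → M₂) (hs₂ : IsRegularSection k d₂ s₂)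
    (Φ : OrbitSpace k M₁ ≃ OrbitSpace k M₂) (hΦ : IsOrbitDiffeomorphism k d₁ d₂ Φ)
    (hchar : ∀ p, characteristicFunction k p = characteristicFunction k (Φ p)) :
    ∃! Ψ : Diffeomorph (𝓡 d₁) (𝓡 d₂) M₁ M₂ ∞,
      (∀ (t : Torus k) (x : M₁), Ψ (t • x) = t • Ψ x) ∧ ∀ p, Ψ (s₁ p) = s₂ (Φ p) := by
  have hchar' : ∀ q, characteristicFunction k q = characteristicFunction k (Φ.symm q) := fun q => by
    rw [hchar, Φ.apply_symm_apply]
  have hΦ' : IsOrbitDiffeomorphism k d₂ d₁ Φ.symm := ⟨hΦ.2, hΦ.1⟩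
  have hext := equivariantExtension_smul hs₁ hs₂ hchar
  refine ⟨⟨⟨equivariantExtension hs₁ s₂ Φ, equivariantExtension hs₂ s₁ Φ.symm,
    equivariantExtension_leftInverse hs₁ hs₂ hchar,
    equivariantExtension_leftInverse hs₂ hs₁ hchar'⟩,
    contMDiff_equivariantExtension hs₁ hs₂ hΦ hchar,
    contMDiff_equivariantExtension hs₂ hs₁ hΦ' hchar'⟩, ⟨fun t x => ?_, fun p => ?_⟩, ?_⟩
  · obtain ⟨u, hu⟩ := hs₁.exists_smul_eq x
    change equivariantExtension hs₁ s₂ Φ (t • x) = t • equivariantExtension hs₁ s₂ Φ x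
    rw [← hu, smul_smul, hext, hext, mul_smul]
  · have h := hext 1 p
    rw [one_smul, one_smul] at h
    exact h
  · rintro Ψ ⟨hΨ, hΨs⟩
    refine Diffeomorph.ext fun x => ?_
    obtain ⟨u, hu⟩ := hs₁.exists_smul_eq x
    change Ψ x = equivariantExtension hs₁ s₂ Φ x
    rw [← hu, hΨ, hΨs, hext]
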